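/- Let $I$ be a nonempty closed interval of $\mathbb R$ and $\ell\ge 1$ an integer. Let $\mathcal D_I$ be the set of real càdlàg functions on $I$ with Skorokhod's $J_1$ topology (for unbounded $I$: $y_k\to x$ iff there are increasing bijections $\lambda_k$ of $I$ with $\sup_{t\in I}|\lambda_k(t)-t|\to0$ and $y_k\circ\lambda_k\to x$ uniformly on bounded subsets of $I$), and endow $\mathcal D_I^\ell$ with the product topology $J_1^\ell$ and its Borel $\sigma$-field. For $x=(x_1,\dots,x_\ell)\in\mathcal D_I^\ell$ put $\|x\|=\max_{i}\sup_{t\in I}|x_i(t)|$, and let $\mathcal S_{I,\ell}=\{x\in\mathcal D_I^\ell:\|x\|=1\}$ with the induced topology. On $\mathcal Y=(0,\infty]\times\mathcal S_{I,\ell}$ with the product topology, call a set bounded if it is contained in $[\eta,\infty]\times\mathcal S_{I,\ell}$ for some $\eta>0$. Let $\mathcal M(\mathcal Y)$ be the set of Borel measures on $\mathcal Y$ that are finite on bounded Borel sets, endowed with the coarsest topology making $\mu\mapsto\int f\,d\mu$ continuous for every bounded continuous $f:\mathcal Y\to\mathbb R$ with bounded support, and with the corresponding Borel $\sigma$-field.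 Let $\alpha>0$, let $\nu$ be a probability measure on the Borel sets of $\mathcal S_{I,\ell}$, let $(m_n)$ be a sequence of nonnegative integers and, for each $n$, let $X_{1,n},\dots,X_{m_n,n}$ be independent random elements of $\mathcal D_I^\ell$ with $\|X_{i,n}\|<\infty$ a.s. (automatic if $I$ is compact). Assume that for every $x>0$ and every Borel set $A\subset\mathcal S_{I,\ell}$ with $\nu(\partial A)=0$, $$\lim_{n\to\infty}\sum_{i=1}^{m_n}\mathbb P\left(\|X_{i,n}\|>x,\ \frac{X_{i,n}}{\|X_{i,n}\|}\in A\right)=x^{-\alpha}\nu(A),$$ and that for every $x>0$ $$\lim_{n\to\infty}\max_{1\le i\le m_n}\mathbb P\left(\|X_{i,n}\|>x\right)=0 .$$ Let $N_n=\sum_{i=1}^{m_n}\delta_{\left(\|X_{i,n}\|,\,X_{i,n}/\|X_{i,n}\|\right)}$, where the terms with $X_{i,n}=0$ are omitted, and let $N$ be a Poisson point process on $\mathcal Y$ with mean measure $\mu_\alpha(dy\,dw)=\alpha y^{-\alpha-1}\,dy\,\nu(dw)$. Then $N_n$ converges weakly to $N$ as random elements of $\mathcal M(\mathcal Y)$;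 that is, $N_n$ is a random element of $\mathcal M(\mathcal Y)$ and $\mathbb E[F(N_n)]\to\mathbb E[F(N)]$ for every bounded continuous $F:\mathcal M(\mathcal Y)\to\mathbb R$. -/

import Mathlib

open MeasureTheory ProbabilityTheory Filter Topology Set
open scoped ENNReal NNReal BoundedContinuousFunction

noncomputable section

/-! ### The space of càdlàg functions with the `J₁` topology -/

/-- The set `D_I` of real càdlàg functions on `I`: right-continuous, with left limits.  (At the left
endpoint of `I` the left-limit condition is void, at the right endpoint right-continuity is.) -/
structure Cadlag (I : Set ℝ) where
  toFun : I → ℝ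
  right_cont : ∀ t : I, ContinuousWithinAt toFun (Ici t) t
  left_lim : ∀ t : I, ∃ l : ℝ, Tendsto toFun (𝓝[<] t) (𝓝 l)

namespace Cadlag

variable {I : Set ℝ}

instance : CoeFun (Cadlag I) (fun _ => I → ℝ) := ⟨Cadlag.toFun⟩

/-- The basic `J₁`-neighbourhood of `x` with radius `ε`: those `y` for which some increasing
bijection `λ` of `I` onto itself satisfies `|λ t - t| < ε` for all `t ∈ I` and
`|y (λ t) - x t| < ε` for all `t ∈ I` with `|t| < 1 / ε`.  When `I` is compact the restriction on `t`
is void for small `ε`, and these are the balls of the usual Skorokhod metric; when `I` is unbounded,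
they describe `J₁` convergence as uniform convergence, after a uniformly small time change, on
bounded sets of times. -/
def j1Nhd (x : Cadlag I) (ε : ℝ) : Set (Cadlag I) :=
  {y | ∃ lam : I ≃o I, (∀ t : I, |(lam t : ℝ) - t| < ε) ∧
    ∀ t : I, |(t : ℝ)| < 1 / ε → |y (lam t) - x t| < ε}

lemma j1Nhd_mono (x : Cadlag I) {ε ε' : ℝ} (hε : 0 < ε) (h : ε ≤ ε') :
    j1Nhd x ε ⊆ j1Nhd x ε' := by
  rintro y ⟨lam, h1, h2⟩
  refine ⟨lam, fun t => (h1 t).trans_le h, fun t ht => (h2 t (ht.trans_le ?_)).trans_le h⟩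
  exact one_div_le_one_div_of_le hε h

/-- The `J₁` topology on `D_I`. -/
instance : TopologicalSpace (Cadlag I) where
  IsOpen U := ∀ x ∈ U, ∃ ε > 0, j1Nhd x ε ⊆ U
  isOpen_univ := fun _ _ => ⟨1, one_pos, subset_univ _⟩
  isOpen_inter := by
    rintro U V hU hV x ⟨hxU, hxV⟩
    obtain ⟨ε, hε, h⟩ := hU x hxU
    obtain ⟨ε', hε', h'⟩ := hV x hxV
    have hm : 0 < min ε ε' := lt_min hε hε'
    exact ⟨min ε ε', hm, subset_inter ((j1Nhd_mono x hm (min_le_left _ _)).trans h)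
      ((j1Nhd_mono x hm (min_le_right _ _)).trans h')⟩
  isOpen_sUnion := by
    rintro S hS x ⟨U, hU, hx⟩
    obtain ⟨ε, hε, h⟩ := hS U hU x hx
    exact ⟨ε, hε, h.trans (subset_sUnion_of_mem hU)⟩

instance : SMul ℝ (Cadlag I) where
  smul c x :=
    { toFun := fun t => c * x t
      right_cont := fun t => continuousWithinAt_const.mul (x.right_cont t)
      left_lim := fun t => (x.left_lim t).imp' (fun l => c * l) fun _ h => h.const_mul c }

end Cadlag

/-- The space `D_I^ℓ` of `ℓ`-tuples of càdlàg functions. -/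
def CadlagVec (I : Set ℝ) (ℓ : ℕ) : Type := Fin ℓ → Cadlag I

namespace CadlagVec

variable {I : Set ℝ} {ℓ : ℕ}

/-- The product (weak) topology `J₁^ℓ`. -/
instance : TopologicalSpace (CadlagVec I ℓ) :=
  inferInstanceAs (TopologicalSpace (Fin ℓ → Cadlag I))

/-- The Borel σ-field of `(D_I^ℓ, J₁^ℓ)`. -/
instance : MeasurableSpace (CadlagVec I ℓ) := borel _

instance : BorelSpace (CadlagVec I ℓ) := ⟨rfl⟩

/-- `‖x‖ = max_i sup_{t ∈ I} |x_i(t)|`, with values in `[0, ∞]`. -/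
def supNorm (x : CadlagVec I ℓ) : ℝ≥0∞ := ⨆ (i : Fin ℓ) (t : I), ‖x i t‖ₑ

/-- The function `c x`. -/
def scale (c : ℝ) (x : CadlagVec I ℓ) : CadlagVec I ℓ := fun i => c • x i

lemma supNorm_scale (c : ℝ) (x : CadlagVec I ℓ) : supNorm (scale c x) = ‖c‖ₑ * supNorm x := by
  unfold supNorm
  simp only [ENNReal.mul_iSup]
  exact iSup_congr fun i => iSup_congr fun t => enorm_mul c (x i t)

end CadlagVec

open CadlagVec

/-- The unit sphere `S_{I,ℓ}`, with the topology and the Borel σ-field inherited from `D_I^ℓ`. -/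
abbrev UnitSphere (I : Set ℝ) (ℓ : ℕ) : Type := {x : CadlagVec I ℓ // supNorm x = 1}

/-- The half-line `(0, ∞]`. -/
abbrev PosExt : Type := {r : ℝ≥0∞ // 0 < r}

/-- The space `(0, ∞] × S_{I,ℓ}`, with the product topology and the product σ-field; the latter is
the Borel σ-field, because `(0, ∞]` is second countable. -/
abbrev PolarSpace (I : Set ℝ) (ℓ : ℕ) : Type := PosExt × UnitSphere I ℓ

/-- `‖x‖` is neither `0` nor `∞`, so that `x / ‖x‖` makes sense. -/
def HasDirection {I : Set ℝ} {ℓ : ℕ} (x : CadlagVec I ℓ) : Prop :=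
  0 < supNorm x ∧ supNorm x < ∞

/-- The direction `x / ‖x‖`. -/
def direction {I : Set ℝ} {ℓ : ℕ} (x : CadlagVec I ℓ) (h : HasDirection x) : UnitSphere I ℓ :=
  ⟨scale (supNorm x).toReal⁻¹ x, by
    have h0 : 0 < (supNorm x).toReal := ENNReal.toReal_pos h.1.ne' h.2.ne
    rw [supNorm_scale, enorm_inv h0.ne', Real.enorm_eq_ofReal h0.le, ENNReal.ofReal_toReal h.2.ne]
    exact ENNReal.inv_mul_cancel h.1.ne' h.2.ne⟩

/-! ### Boundedly finite measures, weak convergence, point processes -/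

/-- Bounded subsets of `(0, ∞] × S_{I,ℓ}` for the metric `|1/r - 1/r'| + δ(w, w')`, where `δ` is a
bounded metric of `J₁^ℓ`: the sets that stay away from `{0} × S_{I,ℓ}`. -/
def BddAwayFromZero {I : Set ℝ} {ℓ : ℕ} (B : Set (PolarSpace I ℓ)) : Prop :=
  ∃ η : ℝ≥0∞, 0 < η ∧ ∀ p ∈ B, η ≤ (p.1 : ℝ≥0∞)

/-- The set of boundedly finite Borel measures on `(0, ∞] × S_{I,ℓ}`. -/
def BddFinMeasure (I : Set ℝ) (ℓ : ℕ) : Type :=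
  {μ : Measure (PolarSpace I ℓ) // ∀ B, MeasurableSet B → BddAwayFromZero B → μ B < ∞}

/-- Bounded continuous functions on `(0, ∞] × S_{I,ℓ}` with bounded support. -/
abbrev BddSuppFun (I : Set ℝ) (ℓ : ℕ) : Type :=
  {f : PolarSpace I ℓ →ᵇ ℝ // BddAwayFromZero (Function.support f)}

namespace BddFinMeasure

variable {I : Set ℝ} {ℓ : ℕ}

/-- The topology of `w^#`-convergence: the coarsest one for which `μ ↦ ∫ f dμ` is continuous for
every bounded continuous function `f` with bounded support. -/
instance : TopologicalSpace (BddFinMeasure I ℓ) :=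
  TopologicalSpace.induced (fun μ (f : BddSuppFun I ℓ) => ∫ p, f.1 p ∂μ.1) inferInstance

/-- The Borel σ-field. -/
instance : MeasurableSpace (BddFinMeasure I ℓ) := borel _

instance : BorelSpace (BddFinMeasure I ℓ) := ⟨rfl⟩

end BddFinMeasure

/-- `N` is a Poisson point process on `(0, ∞] × S_{I,ℓ}` with mean measure `μ`: a random point
measure whose values on disjoint bounded Borel sets are independent, the value on `B` being Poisson
with mean `μ B`. -/
structure IsPoissonPointProcess {I : Set ℝ} {ℓ : ℕ} {Ω : Type*} [MeasurableSpace Ω]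
    (P : Measure Ω) (N : Ω → BddFinMeasure I ℓ) (μ : Measure (PolarSpace I ℓ)) : Prop where
  measurable : Measurable N
  point_measure : ∀ᵐ ω ∂P, ∀ B, MeasurableSet B → BddAwayFromZero B →
    ∃ k : ℕ, (N ω).1 B = k
  bounded_mean : ∀ B, MeasurableSet B → BddAwayFromZero B → μ B < ∞
  poisson : ∀ B, MeasurableSet B → BddAwayFromZero B →
    P.map (fun ω => (N ω).1 B) = (poissonMeasure (μ B).toNNReal).map (fun k : ℕ => (k : ℝ≥0∞))
  indep : ∀ (k : ℕ) (B : Fin k → Set (PolarSpace I ℓ)), (∀ i, MeasurableSet (B i)) →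
    (∀ i, BddAwayFromZero (B i)) → Pairwise (fun i j => Disjoint (B i) (B j)) →
    iIndepFun (fun i ω => (N ω).1 (B i)) P

/-! ### Exceedances -/

open Classical in
/-- The unit mass at `(‖x‖, x / ‖x‖)`; the null measure if `x = 0`. -/
def polarMass {I : Set ℝ} {ℓ : ℕ} (x : CadlagVec I ℓ) : Measure (PolarSpace I ℓ) :=
  if h : HasDirection x then Measure.dirac (⟨supNorm x, h.1⟩, direction x h) else 0

/-- The point process of exceedances `∑_i δ_{(‖x_i‖, x_i / ‖x_i‖)}`. -/
def exceedances {I : Set ℝ} {ℓ m : ℕ} (x : Fin m → CadlagVec I ℓ) : BddFinMeasure I ℓ :=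
  ⟨∑ i, polarMass (x i), fun B _ _ => by
    have : ∀ i, IsFiniteMeasure (polarMass (x i)) := fun i => by
      unfold polarMass; split <;> infer_instance
    exact measure_lt_top _ B⟩

/-- The measure `α y^{-α-1} dy` on `(0, ∞]`. -/
def radialMeasure (α : ℝ) : Measure PosExt :=
  (((volume.restrict (Ioi (0 : ℝ))).withDensity
    (fun y => ENNReal.ofReal (α * y ^ (-α - 1)))).map ENNReal.ofReal).comap Subtype.val

/-- The measure `α y^{-α-1} dy ν(dw)` on `(0, ∞] × S_{I,ℓ}`. -/
def polarMean {I : Set ℝ} {ℓ : ℕ} (α : ℝ) (ν : Measure (UnitSphere I ℓ)) :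
    Measure (PolarSpace I ℓ) :=
  (radialMeasure α).prod ν

end

/-! ### The `J₁` topology is pseudometrizable -/

namespace Cadlag

variable {I : Set ℝ}

/-! Weak convergence is equivalent to the portmanteau inequality `P' (N ∈ G) ≤ liminf P n (N_n ∈ G)`
for open sets `G` of measures. The point is to reduce this inequality to joint convergence of
finitely many counts, without compactness, tightness or any metric on the space of measures.

Both processes are integer-valued. If `μ` is integer-valued and lies in the open set `G`, then `G`
contains every measure that agrees with `μ` on a suitable finite family of cells
(`exists_finset_cell_of_mem_isOpen`). The cells are small, so test functions hardly vary on them.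
Their uncovered remainder has mass decreasing to zero, and an integer below one is zero, so finitely
many cells carry everything away from the origin. The cells come from a countable network, so up to
a null set `N ∈ G` is a countable union of events that prescribe the integer masses of finitely many
cells. Continuity from below leaves finite unions, and for integer counts these are open conditions
(`measure_preimage_le_liminf_exceedances`).

The cells are taken in the ring generated by the rectangles `(x, ∞] × A` with `A` a `ν`-continuity
set. Convergence of the mean measures is assumed on the rectangles and extends to the ring by
linearity. For disjoint sets of the ring, the characteristic function of the vector of counts is a
product of factors close to one, and it tends to that of independent Poisson variables
(`measure_le_liminf_counts`). Arbitrary finite families are decomposed into their atoms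
(`measure_le_liminf_exceedances`).

The countable network, and the measurability of polar coordinates and of the exceedance process,
require `J₁` to be pseudometrizable and second countable. The first holds because the basic
neighbourhoods generate a countably generated uniformity. The second is `Cadlag.separableSpace`: up
to a small time change, a càdlàg function is coded on a bounded window by finitely many rational
values. -/

lemma one_div_add_le_one_div_half_min {ε : ℝ} (hε : 0 < ε) :
    1 / ε + min ε 1 / 2 ≤ 1 / (min ε 1 / 2) := by
  have hm : 0 < min ε 1 := lt_min hε one_pos
  have h1 : 1 / ε ≤ 1 / min ε 1 := one_div_le_one_div_of_le hm (min_le_left _ _)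
  have h2 : 1 ≤ 1 / min ε 1 := (le_div_iff₀ hm).2 (by simp)
  have h3 : 1 / (min ε 1 / 2) = 2 * (1 / min ε 1) := by field_simp
  rw [h3]
  linarith [min_le_right ε 1]

lemma mem_j1Nhd_self (x : Cadlag I) {ε : ℝ} (hε : 0 < ε) : x ∈ j1Nhd x ε :=
  ⟨OrderIso.refl _, fun t => by simpa using hε, fun t _ => by simpa using hε⟩

/-- The inverse time change works, but it may push a point out of the window `|t| < 1 / ε`. With `δ
= min ε 1 / 2` one has `1 / ε + δ ≤ 1 / δ`, so the point stays in the larger window on which the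
hypothesis speaks. The triangle inequality below uses the same radius. -/
lemma mem_j1Nhd_symm {x y : Cadlag I} {ε : ℝ} (hε : 0 < ε) (h : y ∈ j1Nhd x (min ε 1 / 2)) :
    x ∈ j1Nhd y ε := by
  have hm : 0 < min ε 1 := lt_min hε one_pos
  have hle : min ε 1 / 2 ≤ ε := by linarith [min_le_left ε 1]
  obtain ⟨lam, h1, h2⟩ := h
  have h1' : ∀ t : I, |((lam.symm t : I) : ℝ) - t| < min ε 1 / 2 := fun t => by
    have := h1 (lam.symm t)
    rwa [OrderIso.apply_symm_apply, abs_sub_comm] at this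
  refine ⟨lam.symm, fun t => (h1' t).trans_le hle, fun t ht => ?_⟩
  have h3 := h2 (lam.symm t) ?_
  · rw [OrderIso.apply_symm_apply, abs_sub_comm] at h3
    exact h3.trans_le hle
  · have := abs_sub_abs_le_abs_sub ((lam.symm t : I) : ℝ) t
    linarith [h1' t, one_div_add_le_one_div_half_min hε]

lemma mem_j1Nhd_trans {x y z : Cadlag I} {ε : ℝ} (hε : 0 < ε)
    (hxy : y ∈ j1Nhd x (min ε 1 / 2)) (hyz : z ∈ j1Nhd y (min ε 1 / 2)) :
    z ∈ j1Nhd x ε := by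
  have hm : 0 < min ε 1 := lt_min hε one_pos
  have hle : min ε 1 ≤ ε := min_le_left ε 1
  obtain ⟨lam, h1, h2⟩ := hxy
  obtain ⟨kap, h3, h4⟩ := hyz
  have hb := one_div_add_le_one_div_half_min hε
  refine ⟨lam.trans kap, fun t => ?_, fun t ht => ?_⟩
  · have := abs_sub_le ((kap (lam t) : I) : ℝ) (lam t) t
    simp only [OrderIso.trans_apply]
    linarith [h1 t, h3 (lam t)]
  · have := abs_sub_le (z (kap (lam t))) (y (lam t)) (x t)
    have h5 := abs_sub_abs_le_abs_sub ((lam t : I) : ℝ) t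
    simp only [OrderIso.trans_apply]
    linarith [h2 t (by linarith), h4 (lam t) (by linarith [h1 t])]

variable (I) in
/-- The uniformity generated by the basic `J₁`-neighbourhoods. -/
def j1Filter : Filter (Cadlag I × Cadlag I) :=
  ⨅ (ε : ℝ) (_ : 0 < ε), 𝓟 {p | p.2 ∈ j1Nhd p.1 ε}

lemma hasBasis_j1Filter :
    (j1Filter I).HasBasis (fun ε : ℝ => 0 < ε) fun ε => {p | p.2 ∈ j1Nhd p.1 ε} := by
  refine hasBasis_biInf_principal' (fun ε hε δ hδ => ?_) ⟨1, one_pos⟩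
  exact ⟨min ε δ, lt_min hε hδ, fun p hp => j1Nhd_mono p.1 (lt_min hε hδ) (min_le_left _ _) hp,
    fun p hp => j1Nhd_mono p.1 (lt_min hε hδ) (min_le_right _ _) hp⟩

variable (I) in
/-- The uniform structure of the `J₁` topology. -/
def j1Core : UniformSpace.Core (Cadlag I) where
  uniformity := j1Filter I
  refl := by
    intro s hs
    obtain ⟨ε, hε, h⟩ := hasBasis_j1Filter.mem_iff.1 hs
    rintro ⟨x, y⟩ (rfl : x = y)
    exact h (mem_j1Nhd_self x hε)
  symm := by
    refine (hasBasis_j1Filter.tendsto_iff hasBasis_j1Filter).2 fun ε hε => ?_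
    exact ⟨min ε 1 / 2, half_pos (lt_min hε one_pos), fun p hp => mem_j1Nhd_symm hε hp⟩
  comp := by
    intro s hs
    obtain ⟨ε, hε, h⟩ := hasBasis_j1Filter.mem_iff.1 hs
    refine mem_of_superset (mem_lift' (hasBasis_j1Filter.mem_of_mem
      (half_pos (lt_min hε one_pos)))) ?_
    rintro ⟨x, z⟩ ⟨y, hxy, hyz⟩
    exact h (mem_j1Nhd_trans hε hxy hyz)

instance : UniformSpace (Cadlag I) :=
  UniformSpace.ofCoreEq (j1Core I) inferInstance <| by
    refine TopologicalSpace.ext_iff.2 fun U => ?_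
    change (∀ x ∈ U, ∃ ε > 0, j1Nhd x ε ⊆ U) ↔ ∀ x ∈ U, U ∈ comap (Prod.mk x) (j1Filter I)
    refine forall₂_congr fun x _ => ?_
    rw [(hasBasis_j1Filter.comap _).mem_iff]
    rfl

lemma hasBasis_uniformity :
    (uniformity (Cadlag I)).HasBasis (fun ε : ℝ => 0 < ε) fun ε => {p | p.2 ∈ j1Nhd p.1 ε} :=
  hasBasis_j1Filter

/-- The topology is given by its open sets, so it is not evident that `j1Nhd x ε` is a neighbourhood
of `x`. This is what the approximate symmetry and triangle inequality provide. -/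
lemma hasBasis_nhds (x : Cadlag I) : (𝓝 x).HasBasis (fun ε : ℝ => 0 < ε) (j1Nhd x) :=
  nhds_basis_uniformity' hasBasis_uniformity

instance : (uniformity (Cadlag I)).IsCountablyGenerated := by
  refine (HasCountableBasis.mk (p := fun _ : ℕ => True)
    (s := fun n : ℕ => {p : Cadlag I × Cadlag I | p.2 ∈ j1Nhd p.1 (1 / ((n : ℝ) + 1))})
    (hasBasis_uniformity.to_hasBasis (fun ε hε => ?_) fun n _ => ?_)
    (to_countable _)).isCountablyGenerated
  · obtain ⟨n, hn⟩ := exists_nat_one_div_lt hε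
    exact ⟨n, trivial, fun p hp => j1Nhd_mono p.1 Nat.one_div_pos_of_nat hn.le hp⟩
  · exact ⟨_, Nat.one_div_pos_of_nat, subset_rfl⟩

/-! ### Piecewise linear time changes -/

/-- The piecewise linear bijection of `[0, 1]` that maps `t` to `s`. -/
noncomputable def cellMap (t s v : ℝ) : ℝ :=
  if v < t then v * (s / t) else 1 - (1 - v) * ((1 - s) / (1 - t))

/-- Being before the break is preserved. Hence exchanging `t` and `s` selects the matching branch
and inverts the map, and values before and after the breaks are compared with the same constants. -/
lemma cellMap_lt_iff {t s v : ℝ} (ht : t ∈ Ioo (0 : ℝ) 1) (hs : s ∈ Ioo (0 : ℝ) 1) :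
    cellMap t s v < s ↔ v < t := by
  unfold cellMap
  have h1 : 0 < 1 - t := by linarith [ht.2]
  have h2 : 0 < 1 - s := by linarith [hs.2]
  split_ifs with h
  · refine iff_of_true ?_ h
    rw [mul_div_assoc', div_lt_iff₀ ht.1, mul_comm]
    exact mul_lt_mul_of_pos_left h hs.1
  · refine iff_of_false ?_ h
    push Not at h ⊢
    have : (1 - v) * ((1 - s) / (1 - t)) ≤ 1 - s := by
      rw [mul_div_assoc', div_le_iff₀ h1, mul_comm]
      exact mul_le_mul_of_nonneg_left (by linarith) h2.le
    linarith

lemma cellMap_cellMap {t s v : ℝ} (ht : t ∈ Ioo (0 : ℝ) 1) (hs : s ∈ Ioo (0 : ℝ) 1) :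
    cellMap s t (cellMap t s v) = v := by
  have h1 : 1 - t ≠ 0 := by linarith [ht.2]
  have h2 : 1 - s ≠ 0 := by linarith [hs.2]
  have h3 := ht.1.ne'
  have h4 := hs.1.ne'
  rw [cellMap]
  simp only [cellMap_lt_iff ht hs]
  unfold cellMap
  split_ifs with h
  · field_simp
  · field_simp
    ring

lemma cellMap_mem {t s v : ℝ} (ht : t ∈ Ioo (0 : ℝ) 1) (hs : s ∈ Ioo (0 : ℝ) 1)
    (hv : v ∈ Ico (0 : ℝ) 1) : cellMap t s v ∈ Ico (0 : ℝ) 1 := by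
  have h1 : 0 < 1 - t := by linarith [ht.2]
  have h2 : 0 < 1 - s := by linarith [hs.2]
  have h3 : 0 < 1 - v := by linarith [hv.2]
  by_cases h : v < t
  · refine ⟨?_, ((cellMap_lt_iff ht hs).2 h).trans hs.2⟩
    rw [cellMap, if_pos h]
    exact mul_nonneg hv.1 (div_nonneg hs.1.le ht.1.le)
  · refine ⟨hs.1.le.trans (not_lt.1 fun h' => h ((cellMap_lt_iff ht hs).1 h')), ?_⟩
    rw [cellMap, if_neg h]
    have : 0 < (1 - v) * ((1 - s) / (1 - t)) := by positivity
    linarith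

lemma cellMap_mono {t s : ℝ} (ht : t ∈ Ioo (0 : ℝ) 1) (hs : s ∈ Ioo (0 : ℝ) 1) :
    Monotone (cellMap t s) := by
  intro v w hvw
  have h1 : 0 < 1 - t := by linarith [ht.2]
  have h2 : 0 < 1 - s := by linarith [hs.2]
  by_cases h : w < t
  · rw [cellMap, cellMap, if_pos h, if_pos (hvw.trans_lt h)]
    exact mul_le_mul_of_nonneg_right hvw (div_nonneg hs.1.le ht.1.le)
  · by_cases h' : v < t
    · exact ((cellMap_lt_iff ht hs).2 h').le.trans
        (not_lt.1 fun h'' => h ((cellMap_lt_iff ht hs).1 h''))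
    · rw [cellMap, cellMap, if_neg h, if_neg h']
      have := mul_le_mul_of_nonneg_right (sub_le_sub_left hvw 1) (div_nonneg h2.le h1.le)
      linarith

/-- The map of `ℝ` that maps each `[j, j + 1)` to itself, by a translate of `cellMap (t j) (s j)`. -/
noncomputable def gridMap (t s : ℤ → ℝ) (u : ℝ) : ℝ :=
  ⌊u⌋ + cellMap (t ⌊u⌋) (s ⌊u⌋) (Int.fract u)

lemma floor_gridMap {t s : ℤ → ℝ} (ht : ∀ j, t j ∈ Ioo (0 : ℝ) 1)
    (hs : ∀ j, s j ∈ Ioo (0 : ℝ) 1) (u : ℝ) : ⌊gridMap t s u⌋ = ⌊u⌋ := by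
  have := cellMap_mem (ht ⌊u⌋) (hs ⌊u⌋) ⟨Int.fract_nonneg u, Int.fract_lt_one u⟩
  rw [gridMap, Int.floor_intCast_add, Int.floor_eq_zero_iff.2 this, add_zero]

lemma fract_gridMap {t s : ℤ → ℝ} (ht : ∀ j, t j ∈ Ioo (0 : ℝ) 1)
    (hs : ∀ j, s j ∈ Ioo (0 : ℝ) 1) (u : ℝ) :
    Int.fract (gridMap t s u) = cellMap (t ⌊u⌋) (s ⌊u⌋) (Int.fract u) := by
  rw [Int.fract, floor_gridMap ht hs, gridMap, add_sub_cancel_left]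

lemma gridMap_gridMap {t s : ℤ → ℝ} (ht : ∀ j, t j ∈ Ioo (0 : ℝ) 1)
    (hs : ∀ j, s j ∈ Ioo (0 : ℝ) 1) (u : ℝ) : gridMap s t (gridMap t s u) = u := by
  rw [gridMap, floor_gridMap ht hs, fract_gridMap ht hs, cellMap_cellMap (ht _) (hs _),
    Int.floor_add_fract]

lemma gridMap_mono {t s : ℤ → ℝ} (ht : ∀ j, t j ∈ Ioo (0 : ℝ) 1)
    (hs : ∀ j, s j ∈ Ioo (0 : ℝ) 1) : Monotone (gridMap t s) := by
  intro u v huv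
  rcases (Int.floor_mono huv).eq_or_lt with h | h
  · have h1 : Int.fract u ≤ Int.fract v := by
      rw [Int.fract, Int.fract, h]; linarith
    rw [gridMap, gridMap, h]
    linarith [cellMap_mono (ht ⌊v⌋) (hs ⌊v⌋) h1]
  · by_contra hlt
    have := Int.floor_mono (not_le.1 hlt).le
    rw [floor_gridMap ht hs, floor_gridMap ht hs] at this
    omega

lemma abs_gridMap_sub_lt {t s : ℤ → ℝ} (ht : ∀ j, t j ∈ Ioo (0 : ℝ) 1)
    (hs : ∀ j, s j ∈ Ioo (0 : ℝ) 1) (u : ℝ) : |gridMap t s u - u| < 1 := by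
  apply Int.abs_sub_lt_one_of_floor_eq_floor
  exact floor_gridMap ht hs u

/-! ### Grids that are compatible with an interval -/

/-- The open cells of the grid `g + h ℤ` lie either in `I` or in its complement. -/
def GridCompat (I : Set ℝ) (g h : ℝ) : Prop :=
  ∀ u v : ℝ, g + h * u ∈ I → ⌊u⌋ = ⌊v⌋ → Int.fract u ≠ 0 → g + h * v ∈ I

/-- The finite endpoints of `I` have to be grid points. The origin `g` is one of them if there is
any, and only the mesh depends on `δ`. -/
lemma exists_gridCompat (hne : I.Nonempty) (hcl : IsClosed I) (hoc : I.OrdConnected) :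
    ∃ g : ℝ, ∀ δ > 0, ∃ h, 0 < h ∧ h < δ ∧ GridCompat I g h := by
  have hfl : ∀ u : ℝ, Int.fract u ≠ 0 → (⌊u⌋ : ℝ) ≠ u := fun u hu h => hu (by simp [Int.fract, h])
  by_cases hb : BddBelow I
  · have ha : sInf I ∈ I := hcl.csInf_mem hne hb
    have hle : ∀ u ∈ I, sInf I ≤ u := fun u hu => csInf_le hb hu
    refine ⟨sInf I, fun δ hδ => ?_⟩
    by_cases hB : BddAbove I
    · have hb' : sSup I ∈ I := hcl.csSup_mem hne hB
      have hle' : ∀ u ∈ I, u ≤ sSup I := fun u hu => le_csSup hB hu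
      -- If `I` is a single point, any mesh works, because only the grid point `0` lies in `I`.
      -- Otherwise the mesh must divide the length of `I`.
      rcases (hle _ hb').eq_or_lt with hab | hab
      · refine ⟨δ / 2, by linarith, by linarith, fun u v hu huv hf => ?_⟩
        have h1 := hle _ hu
        have h2 := hle' _ hu
        have : u = 0 := by
          have : δ / 2 * u = 0 := by linarith
          rcases mul_eq_zero.1 this with h | h
          · linarith
          · exact h
        simp [this] at hf
      · set L := sSup I - sInf I with hL
        have hL0 : 0 < L := by linarith
        obtain ⟨n, hn⟩ := exists_nat_gt (L / δ)
        have hn0 : (0 : ℝ) < n := (div_pos hL0 hδ).trans hn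
        have hh : 0 < L / n := div_pos hL0 hn0
        refine ⟨L / n, hh, by rwa [div_lt_comm₀ hn0 hδ], fun u v hu huv hf => ?_⟩
        have hu0 : 0 ≤ u := by
          have := hle _ hu
          by_contra h
          nlinarith
        have hun : u ≤ n := by
          have h1 := hle' _ hu
          have h2 : L / n * u ≤ L / n * n := by rw [div_mul_cancel₀ _ hn0.ne']; linarith
          exact le_of_mul_le_mul_left h2 hh
        have h0 : 0 ≤ v := by
          have : 0 ≤ ⌊v⌋ := huv ▸ Int.floor_nonneg.2 hu0
          exact Int.floor_nonneg.1 this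
        have h1 : v ≤ n := by
          have h3 : (⌊u⌋ : ℝ) < ((n : ℤ) : ℝ) := by
            have := (Int.floor_le u).lt_of_ne (hfl u hf)
            push_cast; linarith
          have h4 : ⌊v⌋ + 1 ≤ (n : ℤ) := huv ▸ Int.cast_lt.1 h3
          have h5 : ((⌊v⌋ + 1 : ℤ) : ℝ) ≤ ((n : ℤ) : ℝ) := Int.cast_le.2 h4
          push_cast at h5
          linarith [Int.lt_floor_add_one v]
        refine hoc.out ha hb' ⟨by nlinarith, ?_⟩
        have : L / n * v ≤ L / n * n := by nlinarith
        rw [div_mul_cancel₀ _ hn0.ne'] at this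
        linarith
    · refine ⟨δ / 2, by linarith, by linarith, fun u v hu huv hf => ?_⟩
      have hu0 : 0 ≤ u := by
        have := hle _ hu
        by_contra h
        nlinarith
      have h0 : 0 ≤ v := Int.floor_nonneg.1 (huv ▸ Int.floor_nonneg.2 hu0)
      obtain ⟨c, hc, hc'⟩ := not_bddAbove_iff.1 hB (sInf I + δ / 2 * v)
      exact hoc.out ha hc ⟨by nlinarith, hc'.le⟩
  · by_cases hB : BddAbove I
    · have hb' : sSup I ∈ I := hcl.csSup_mem hne hB
      have hle' : ∀ u ∈ I, u ≤ sSup I := fun u hu => le_csSup hB hu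
      refine ⟨sSup I, fun δ hδ => ⟨δ / 2, by linarith, by linarith, fun u v hu huv hf => ?_⟩⟩
      have hu0 : u ≤ 0 := by
        have := hle' _ hu
        by_contra h
        nlinarith
      have h0 : v ≤ 0 := by
        have h3 : (⌊u⌋ : ℝ) < ((0 : ℤ) : ℝ) := by
          have := (Int.floor_le u).lt_of_ne (hfl u hf)
          push_cast; linarith
        have h4 : ⌊v⌋ + 1 ≤ (0 : ℤ) := huv ▸ Int.cast_lt.1 h3
        have h5 : ((⌊v⌋ + 1 : ℤ) : ℝ) ≤ ((0 : ℤ) : ℝ) := Int.cast_le.2 h4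
        push_cast at h5
        linarith [Int.lt_floor_add_one v]
      obtain ⟨c, hc, hc'⟩ := not_bddBelow_iff.1 hb (sSup I + δ / 2 * v)
      exact hoc.out hc hb' ⟨hc'.le, by nlinarith⟩
    · refine ⟨0, fun δ hδ => ⟨δ / 2, by linarith, by linarith, fun u v _ _ _ => ?_⟩⟩
      obtain ⟨c, hc, hc'⟩ := not_bddBelow_iff.1 hb (0 + δ / 2 * v)
      obtain ⟨d, hd, hd'⟩ := not_bddAbove_iff.1 hB (0 + δ / 2 * v)
      exact hoc.out hc hd ⟨hc'.le, hd'.le⟩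

/-- The time change of `I` induced by a map of the cells of a compatible grid. -/
lemma exists_gridIso {g h : ℝ} (hh : 0 < h) (hc : GridCompat I g h) {t s : ℤ → ℝ}
    (ht : ∀ j, t j ∈ Ioo (0 : ℝ) 1) (hs : ∀ j, s j ∈ Ioo (0 : ℝ) 1) :
    ∃ lam : I ≃o I, ∀ u : I, (lam u : ℝ) = g + h * gridMap t s ((u - g) / h) := by
  have hg0 : ∀ {t s : ℤ → ℝ}, (∀ j, t j ∈ Ioo (0 : ℝ) 1) → (∀ j, s j ∈ Ioo (0 : ℝ) 1) →
      ∀ u ∈ I, g + h * gridMap t s ((u - g) / h) ∈ I := by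
    intro t s ht hs u hu
    have hu' : g + h * ((u - g) / h) = u := by field_simp; ring
    -- Grid points are fixed; other points stay in their open cell, which lies in `I` as soon as it
    -- meets `I`.
    by_cases hf : Int.fract ((u - g) / h) = 0
    · have : gridMap t s ((u - g) / h) = (u - g) / h := by
        conv_rhs => rw [← Int.floor_add_fract ((u - g) / h), hf]
        rw [gridMap, hf, cellMap, if_pos (ht _).1, zero_mul]
      rwa [this, hu']
    · exact hc _ _ (by rwa [hu']) (floor_gridMap ht hs _).symm hf
  have hinv : ∀ {t s : ℤ → ℝ}, (∀ j, t j ∈ Ioo (0 : ℝ) 1) → (∀ j, s j ∈ Ioo (0 : ℝ) 1) →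
      ∀ u : ℝ, g + h * gridMap s t ((g + h * gridMap t s ((u - g) / h) - g) / h) = u := by
    intro t s ht hs u
    rw [add_sub_cancel_left, mul_div_cancel_left₀ _ hh.ne', gridMap_gridMap ht hs]
    field_simp
    ring
  have hmono : ∀ {t s : ℤ → ℝ}, (∀ j, t j ∈ Ioo (0 : ℝ) 1) → (∀ j, s j ∈ Ioo (0 : ℝ) 1) →
      Monotone fun u : ℝ => g + h * gridMap t s ((u - g) / h) := by
    intro t s ht hs u v huv
    have := gridMap_mono ht hs (div_le_div_of_nonneg_right (sub_le_sub_right huv g) hh.le)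
    have := mul_le_mul_of_nonneg_left this hh.le
    simpa using this
  let e : I ≃ I :=
    { toFun := fun u => ⟨_, hg0 ht hs u u.2⟩
      invFun := fun u => ⟨_, hg0 hs ht u u.2⟩
      left_inv := fun u => Subtype.ext (hinv ht hs u)
      right_inv := fun u => Subtype.ext (hinv hs ht u) }
  exact ⟨e.toOrderIso (fun u v huv => hmono ht hs huv) fun u v huv => hmono hs ht huv,
    fun u => rfl⟩

/-! ### Separability -/

/-- On the `j`-th cell of the grid `g + h ℤ`, the function `x` is `ε`-close to `a` before some
interior point and `ε`-close to `b` from this point on. -/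
def CellApprox (x : Cadlag I) (g h ε : ℝ) (j : ℤ) (a b : ℝ) (t : ℝ) : Prop :=
  ∀ u : I, ⌊((u : ℝ) - g) / h⌋ = j →
    (Int.fract (((u : ℝ) - g) / h) < t → |x u - a| < ε) ∧
    (t ≤ Int.fract (((u : ℝ) - g) / h) → |x u - b| < ε)

/-- Two functions with the same code are close: in each cell the time change moves the break of `x`
to that of `y`, so both are compared with the same constant. It keeps every cell, hence moves points
by less than `h`. The bound on `J` makes the cells in question cover the window. -/
lemma mem_j1Nhd_of_cellApprox {x y : Cadlag I} {g h ε : ℝ} (hh : 0 < h) (hhε : h ≤ ε)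
    (hc : GridCompat I g h) {J : ℕ} (hJ : 1 / ε + |g| ≤ h * J) {a b : ℤ → ℝ}
    (hx : ∀ j : ℤ, |j| ≤ J + 1 → ∃ t ∈ Ioo (0 : ℝ) 1, CellApprox x g h (ε / 2) j (a j) (b j) t)
    (hy : ∀ j : ℤ, |j| ≤ J + 1 → ∃ t ∈ Ioo (0 : ℝ) 1, CellApprox y g h (ε / 2) j (a j) (b j) t) :
    y ∈ j1Nhd x ε := by
  have key : ∀ z : Cadlag I, (∀ j : ℤ, |j| ≤ J + 1 →
      ∃ t ∈ Ioo (0 : ℝ) 1, CellApprox z g h (ε / 2) j (a j) (b j) t) →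
      ∃ t : ℤ → ℝ, (∀ j, t j ∈ Ioo (0 : ℝ) 1) ∧
        ∀ j : ℤ, |j| ≤ J + 1 → CellApprox z g h (ε / 2) j (a j) (b j) (t j) := by
    intro z hz
    have : ∀ j : ℤ, ∃ t ∈ Ioo (0 : ℝ) 1, |j| ≤ J + 1 →
        CellApprox z g h (ε / 2) j (a j) (b j) t := by
      intro j
      by_cases hj : |j| ≤ J + 1
      · obtain ⟨t, h1, h2⟩ := hz j hj
        exact ⟨t, h1, fun _ => h2⟩
      -- Outside the window nothing is required, and any interior break serves.
      · exact ⟨1 / 2, by norm_num, fun h => absurd h hj⟩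
    choose t h1 h2 using this
    exact ⟨t, h1, h2⟩
  obtain ⟨t, ht, hxt⟩ := key x hx
  obtain ⟨s, hs, hys⟩ := key y hy
  obtain ⟨lam, hlam⟩ := exists_gridIso hh hc ht hs
  have hlam' : ∀ u : I, ((lam u : ℝ) - g) / h = gridMap t s (((u : ℝ) - g) / h) := fun u => by
    rw [hlam, add_sub_cancel_left, mul_div_cancel_left₀ _ hh.ne']
  refine ⟨lam, fun u => ?_, fun u hu => ?_⟩
  · have h1 := abs_gridMap_sub_lt ht hs (((u : ℝ) - g) / h)
    have h2 : (lam u : ℝ) - u = h * (gridMap t s (((u : ℝ) - g) / h) - ((u : ℝ) - g) / h) := by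
      rw [hlam]; field_simp; ring
    rw [h2, abs_mul, abs_of_pos hh]
    exact (mul_lt_of_lt_one_right hh h1).trans_le hhε
  · set w := ((u : ℝ) - g) / h with hw
    have hwJ : |w| ≤ J := by
      rw [hw, abs_div, abs_of_pos hh, div_le_iff₀ hh]
      have := abs_sub (u : ℝ) g
      linarith
    have hj : |⌊w⌋| ≤ (J : ℤ) + 1 := by
      rw [abs_le] at hwJ ⊢
      constructor
      · have : (-(J : ℤ)) ≤ ⌊w⌋ := Int.le_floor.2 (by push_cast; exact hwJ.1)
        linarith
      · have : (⌊w⌋ : ℝ) ≤ ((J : ℤ) : ℝ) := (Int.floor_le w).trans (by simpa using hwJ.2)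
        linarith [Int.cast_le.1 this]
    have h1 := hxt ⌊w⌋ hj u rfl
    have h2 := hys ⌊w⌋ hj (lam u) (by rw [hlam', floor_gridMap ht hs])
    rw [hlam', fract_gridMap ht hs] at h2
    by_cases hlt : Int.fract w < t ⌊w⌋
    · have h3 := h1.1 hlt
      have h4 := h2.1 ((cellMap_lt_iff (ht _) (hs _)).2 hlt)
      have := abs_sub_le (y (lam u)) (a ⌊w⌋) (x u)
      rw [abs_sub_comm] at h3
      linarith
    · have h3 := h1.2 (not_lt.1 hlt)
      have h4 := h2.2 (not_lt.1 fun h => hlt ((cellMap_lt_iff (ht _) (hs _)).1 h))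
      have := abs_sub_le (y (lam u)) (b ⌊w⌋) (x u)
      rw [abs_sub_comm] at h3
      linarith

lemma exists_local_approx (hcl : IsClosed I) (x : Cadlag I) {ε : ℝ} (hε : 0 < ε) (p : ℝ) :
    ∃ d > 0, ∃ a b : ℝ, ∀ u : I, |(u : ℝ) - p| < d →
      ((u : ℝ) < p → |x u - a| < ε) ∧ (p ≤ u → |x u - b| < ε) := by
  by_cases hp : p ∈ I
  · obtain ⟨l, hl⟩ := x.left_lim ⟨p, hp⟩
    have h1 := Metric.tendsto_nhds.1 hl ε hε
    have h2 := Metric.tendsto_nhds.1 (x.right_cont ⟨p, hp⟩) ε hε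
    rw [eventually_nhdsWithin_iff, Metric.eventually_nhds_iff] at h1 h2
    obtain ⟨d₁, hd₁, h1⟩ := h1
    obtain ⟨d₂, hd₂, h2⟩ := h2
    refine ⟨min d₁ d₂, lt_min hd₁ hd₂, l, x ⟨p, hp⟩, fun u hu => ⟨fun h => ?_, fun h => ?_⟩⟩
    · exact h1 (y := u) (hu.trans_le (min_le_left _ _)) h
    · exact h2 (y := u) (hu.trans_le (min_le_right _ _)) h
  · obtain ⟨d, hd, h⟩ := Metric.isOpen_iff.1 hcl.isOpen_compl p hp
    exact ⟨d, hd, 0, 0, fun u hu => absurd u.2 (h hu)⟩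

/-- Near each `p` the function is close to one constant before `p` and to another from `p` on. By
the Lebesgue number lemma, every sufficiently short cell lies in such a neighbourhood, so one break
per cell is enough. -/
lemma exists_cellApprox (hcl : IsClosed I) (x : Cadlag I) {ε : ℝ} (hε : 0 < ε) (M : ℝ) :
    ∃ δ > 0, ∀ g h : ℝ, 0 < h → h < δ → ∀ j : ℤ, |g + h * j| ≤ M →
      ∃ (a b : ℚ), ∃ t ∈ Ioo (0 : ℝ) 1, CellApprox x g h ε j a b t := by
  choose d hd a b hab using exists_local_approx hcl x (half_pos hε)
  obtain ⟨δ, hδ, H⟩ := lebesgue_number_lemma_of_metric (isCompact_Icc (a := -M) (b := M))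
    (c := fun p => Metric.ball p (d p)) (fun p => Metric.isOpen_ball)
    (fun p _ => mem_iUnion.2 ⟨p, Metric.mem_ball_self (hd p)⟩)
  refine ⟨δ, hδ, fun g h hh hhδ j hj => ?_⟩
  obtain ⟨p, hp⟩ := H (g + h * j) (abs_le.1 hj)
  obtain ⟨qa, hqa⟩ := exists_rat_near (a p) (half_pos hε)
  obtain ⟨qb, hqb⟩ := exists_rat_near (b p) (half_pos hε)
  have hcell : ∀ u : I, ⌊((u : ℝ) - g) / h⌋ = j →
      (u : ℝ) = g + h * j + h * Int.fract (((u : ℝ) - g) / h) ∧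
      ((u : ℝ) < p → |x u - qa| < ε) ∧ (p ≤ u → |x u - qb| < ε) := by
    intro u hu
    have h1 : (u : ℝ) = g + h * j + h * Int.fract (((u : ℝ) - g) / h) := by
      rw [add_assoc, ← mul_add, ← hu, Int.floor_add_fract]
      field_simp
      ring
    have h2 : (u : ℝ) ∈ Metric.ball p (d p) := by
      apply hp
      rw [Metric.mem_ball, Real.dist_eq, h1, add_sub_cancel_left, abs_mul, abs_of_pos hh,
        abs_of_nonneg (Int.fract_nonneg _)]
      exact (mul_lt_of_lt_one_right hh (Int.fract_lt_one _)).trans hhδ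
    have h3 := hab p u h2
    refine ⟨h1, fun h => ?_, fun h => ?_⟩
    · linarith [abs_sub_le (x u) (a p) qa, h3.1 h]
    · linarith [abs_sub_le (x u) (b p) qb, h3.2 h]
  -- If `p` is not interior to the cell, a single constant suffices and the break `1 / 2` is
  -- arbitrary.
  by_cases h1 : p ≤ g + h * j
  · refine ⟨qb, qb, 1 / 2, by norm_num, fun u hu => ?_⟩
    obtain ⟨h2, -, h3⟩ := hcell u hu
    have := mul_nonneg hh.le (Int.fract_nonneg (((u : ℝ) - g) / h))
    exact ⟨fun _ => h3 (by linarith), fun _ => h3 (by linarith)⟩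
  · by_cases h1' : g + h * j + h ≤ p
    · refine ⟨qa, qa, 1 / 2, by norm_num, fun u hu => ?_⟩
      obtain ⟨h2, h3, -⟩ := hcell u hu
      have := mul_lt_of_lt_one_right hh (Int.fract_lt_one (((u : ℝ) - g) / h))
      exact ⟨fun _ => h3 (by linarith), fun _ => h3 (by linarith)⟩
    · push Not at h1 h1'
      refine ⟨qa, qb, (p - (g + h * j)) / h, ⟨div_pos (by linarith) hh, ?_⟩, fun u hu => ?_⟩
      · rw [div_lt_one hh]; linarith
      · obtain ⟨h2, h3, h4⟩ := hcell u hu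
        rw [lt_div_iff₀ hh, div_le_iff₀ hh]
        exact ⟨fun h => h3 (by linarith), fun h => h4 (by linarith)⟩

theorem separableSpace (hne : I.Nonempty) (hcl : IsClosed I) (hoc : I.OrdConnected) :
    TopologicalSpace.SeparableSpace (Cadlag I) := by
  obtain ⟨g, hg⟩ := exists_gridCompat hne hcl hoc
  choose! H hH0 hHlt hHc using hg
  -- A code consists of a precision, a mesh, a window and the rational values on the cells; finite
  -- support keeps the set of codes countable. One member of each nonempty class is chosen, so no
  -- step function has to be constructed.
  let K : ℕ × ℕ × ℕ × (ℤ →₀ ℚ × ℚ) → Set (Cadlag I) := fun c =>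
    {x | ∀ j : ℤ, |j| ≤ (c.2.2.1 : ℤ) + 1 → ∃ t ∈ Ioo (0 : ℝ) 1,
      CellApprox x g (H (1 / ((c.2.1 : ℝ) + 1))) (1 / ((c.1 : ℝ) + 1) / 2) j
        (c.2.2.2 j).1 (c.2.2.2 j).2 t}
  classical
  let S : Set (Cadlag I) := {x | ∃ c, ∃ h : (K c).Nonempty, x = h.some}
  have hS : S.Countable := by
    have : S ⊆ range fun c => if h : (K c).Nonempty then h.some else ⟨fun _ => 0,
        fun _ => continuousWithinAt_const, fun _ => ⟨0, tendsto_const_nhds⟩⟩ := by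
      rintro x ⟨c, h, rfl⟩
      exact ⟨c, dif_pos h⟩
    exact (countable_range _).mono this
  refine ⟨S, hS, fun x => ?_⟩
  rw [mem_closure_iff_nhds_basis (hasBasis_nhds x)]
  intro ε hε
  obtain ⟨n, hn⟩ := exists_nat_one_div_lt hε
  set e : ℝ := 1 / ((n : ℝ) + 1) with he
  have he0 : 0 < e := Nat.one_div_pos_of_nat
  -- The bound covers `|g| + h * (J + 1)`, since below `h * J ≤ 1 / e + |g| + 1` and `h < 1`.
  obtain ⟨δ, hδ, hx⟩ := exists_cellApprox hcl x (half_pos he0) (1 / e + 2 * |g| + 3)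
  obtain ⟨k, hk⟩ := exists_nat_one_div_lt (lt_min (lt_min hδ he0) one_pos)
  set h : ℝ := H (1 / ((k : ℝ) + 1)) with hh
  have hk0 : (0 : ℝ) < 1 / ((k : ℝ) + 1) := Nat.one_div_pos_of_nat
  have hh0 : 0 < h := hH0 _ hk0
  have hhlt : h < min (min δ e) 1 := (hHlt _ hk0).trans hk
  have hhδ : h < δ := hhlt.trans_le ((min_le_left _ _).trans (min_le_left _ _))
  have hhe : h < e := hhlt.trans_le ((min_le_left _ _).trans (min_le_right _ _))
  have hh1 : h < 1 := hhlt.trans_le (min_le_right _ _)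
  set J : ℕ := ⌈(1 / e + |g|) / h⌉₊ with hJ
  have hJ0 : 0 ≤ (1 / e + |g|) / h := by positivity
  have hJ1 : 1 / e + |g| ≤ h * J := by
    rw [mul_comm, ← div_le_iff₀ hh0]
    exact Nat.le_ceil _
  have hJ2 : h * J ≤ 1 / e + |g| + 1 := by
    have h1 : (J : ℝ) < (1 / e + |g|) / h + 1 := Nat.ceil_lt_add_one hJ0
    have h2 := mul_le_mul_of_nonneg_left h1.le hh0.le
    rw [mul_add, mul_div_cancel₀ _ hh0.ne'] at h2
    linarith
  have hcell : ∀ j : ℤ, |j| ≤ (J : ℤ) + 1 → ∃ (q : ℚ × ℚ), ∃ t ∈ Ioo (0 : ℝ) 1,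
      CellApprox x g h (e / 2) j q.1 q.2 t := by
    intro j hj
    obtain ⟨a, b, H⟩ := hx g h hh0 hhδ j <| by
      have h1 : |(j : ℝ)| ≤ J + 1 := by exact_mod_cast hj
      have h2 := mul_le_mul_of_nonneg_left h1 hh0.le
      have h3 := abs_add_le g (h * j)
      rw [abs_mul, abs_of_pos hh0] at h3
      linarith
    exact ⟨(a, b), H⟩
  choose! q hq using hcell
  have hfin : {j : ℤ | |j| ≤ (J : ℤ) + 1}.Finite :=
    (Set.finite_Icc (-((J : ℤ) + 1)) (J + 1)).subset fun j hj => abs_le.1 hj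
  let c : ℕ × ℕ × ℕ × (ℤ →₀ ℚ × ℚ) :=
    (n, k, J, Finsupp.indicator hfin.toFinset fun j _ => q j)
  have hxK : x ∈ K c := by
    intro j hj
    have : c.2.2.2 j = q j := Finsupp.indicator_of_mem (hfin.mem_toFinset.2 hj) fun j _ => q j
    rw [this]
    exact hq j hj
  have hne' : (K c).Nonempty := ⟨x, hxK⟩
  refine ⟨hne'.some, ⟨c, hne', rfl⟩, j1Nhd_mono x he0 hn.le ?_⟩
  exact mem_j1Nhd_of_cellApprox hh0 hhe.le (hHc _ hk0) hJ1 hxK hne'.some_mem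

end Cadlag

/-! ### The spaces of vectors, and measurability of exceedances -/

namespace Cadlag

variable {I : Set ℝ}

lemma secondCountableTopology (hne : I.Nonempty) (hcl : IsClosed I) (hoc : I.OrdConnected) :
    SecondCountableTopology (Cadlag I) :=
  haveI := separableSpace hne hcl hoc
  UniformSpace.secondCountable_of_separable _

/-- A value exceeding `c` in norm at time `t` persists at the time `lam t` for all functions near
`x`. On unbounded `I` the supremum need not be continuous, since `J₁` only controls bounded windows.
-/
lemma lowerSemicontinuous_iSup_enorm :
    LowerSemicontinuous fun x : Cadlag I => ⨆ t : I, ‖x t‖ₑ := by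
  refine lowerSemicontinuous_iff_isOpen_preimage.2 fun c => isOpen_iff_mem_nhds.2 fun x hx => ?_
  obtain ⟨t, ht⟩ := lt_iSup_iff.1 (show c < _ from hx)
  have h1 : ∀ᶠ r : ℝ in 𝓝 (x t), c < ‖r‖ₑ := continuous_enorm.continuousAt.eventually_const_lt ht
  obtain ⟨δ, hδ, h1⟩ := Metric.eventually_nhds_iff.1 h1
  -- A radius of at most this size puts `t` inside the window.
  have hp : (0 : ℝ) < 1 / (|(t : ℝ)| + 1) := by positivity
  have hm := lt_min hδ hp
  refine mem_of_superset ((hasBasis_nhds x).mem_of_mem hm) ?_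
  rintro y ⟨lam, -, h2⟩
  refine (lt_iSup_iff (f := fun t => ‖y t‖ₑ)).2 ⟨lam t, h1 (y := y (lam t)) ?_⟩
  refine (h2 t ?_).trans_le (min_le_left _ _)
  have h3 := one_div_le_one_div_of_le hm (min_le_right δ (1 / (|(t : ℝ)| + 1)))
  rw [one_div_one_div] at h3
  linarith

/-- Along the same time change, `d y - c x = d (y - x) + (d - c) x`; the bound on `x` controls the
last term. -/
lemma continuousAt_smul (c : ℝ) (x : Cadlag I) {K : ℝ} (hK : ∀ t, |x t| ≤ K) :
    ContinuousAt (fun p : ℝ × Cadlag I => p.1 • p.2) (c, x) := by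
  rw [ContinuousAt, (hasBasis_nhds (c • x)).tendsto_right_iff]
  intro ε hε
  obtain ⟨δ, hδ, hδε⟩ : ∃ δ > 0, δ * (|c| + 1 + |K| + 1) < ε :=
    ⟨ε / (|c| + 1 + |K| + 1) / 2, by positivity, by
      rw [div_mul_eq_mul_div, div_mul_cancel₀ _ (by positivity)]; linarith⟩
  have hm : 0 < min δ (min ε 1) := lt_min hδ (lt_min hε one_pos)
  have h1 : Metric.ball c (min δ 1) ∈ 𝓝 c := Metric.ball_mem_nhds _ (lt_min hδ one_pos)
  refine mem_of_superset (prod_mem_nhds h1 ((hasBasis_nhds x).mem_of_mem hm)) ?_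
  rintro ⟨d, y⟩ ⟨hd, lam, h2, h3⟩
  rw [Metric.mem_ball, Real.dist_eq, lt_min_iff] at hd
  have hmε : min δ (min ε 1) ≤ ε := (min_le_right _ _).trans (min_le_left _ _)
  refine ⟨lam, fun t => (h2 t).trans_le hmε, fun t ht => ?_⟩
  have h4 : |y (lam t) - x t| < δ :=
    (h3 t (ht.trans_le (one_div_le_one_div_of_le hm hmε))).trans_le (min_le_left _ _)
  have h5 : d * y (lam t) - c * x t = d * (y (lam t) - x t) + (d - c) * x t := by ring
  have h6 : |d| ≤ |c| + 1 := by linarith [abs_sub_abs_le_abs_sub d c]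
  change |d * y (lam t) - c * x t| < ε
  rw [h5]
  refine ((abs_add_le _ _).trans ?_).trans_lt hδε
  rw [abs_mul, abs_mul]
  have h7 : |d| * |y (lam t) - x t| ≤ (|c| + 1) * δ :=
    mul_le_mul h6 h4.le (abs_nonneg _) (by positivity)
  have h8 : |d - c| * |x t| ≤ δ * |K| :=
    mul_le_mul hd.1.le ((hK t).trans (le_abs_self K)) (abs_nonneg _) hδ.le
  linarith

end Cadlag

open CadlagVec

section

variable {I : Set ℝ} {ℓ : ℕ}

namespace CadlagVec

instance : TopologicalSpace.PseudoMetrizableSpace (CadlagVec I ℓ) :=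
  inferInstanceAs (TopologicalSpace.PseudoMetrizableSpace (Fin ℓ → Cadlag I))

lemma secondCountableTopology (hne : I.Nonempty) (hcl : IsClosed I) (hoc : I.OrdConnected) :
    SecondCountableTopology (CadlagVec I ℓ) :=
  haveI := Cadlag.secondCountableTopology hne hcl hoc
  inferInstanceAs (SecondCountableTopology (Fin ℓ → Cadlag I))

lemma continuous_coord (i : Fin ℓ) : Continuous fun x : CadlagVec I ℓ => x i :=
  continuous_apply (A := fun _ : Fin ℓ => Cadlag I) i

lemma measurable_supNorm : Measurable (supNorm : CadlagVec I ℓ → ℝ≥0∞) := by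
  refine LowerSemicontinuous.measurable (lowerSemicontinuous_iSup fun i => ?_)
  exact Cadlag.lowerSemicontinuous_iSup_enorm.comp (continuous_coord i)

lemma continuous_scale :
    Continuous fun p : ℝ × {x : CadlagVec I ℓ // supNorm x < ∞} => scale p.1 p.2.1 := by
  refine continuous_pi (A := fun _ : Fin ℓ => Cadlag I) fun i => continuous_iff_continuousAt.2 ?_
  rintro ⟨c, x, hx⟩
  have hK : ∀ t, |x i t| ≤ (supNorm x).toReal := by
    intro t
    have h1 : ‖x i t‖ₑ ≤ supNorm x :=
      (le_iSup (fun t => ‖x i t‖ₑ) t).trans (le_iSup (fun i => ⨆ t, ‖x i t‖ₑ) i)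
    have h2 := ENNReal.toReal_mono hx.ne h1
    simpa using h2
  have h1 : Continuous fun p : ℝ × {x : CadlagVec I ℓ // supNorm x < ∞} => (p.1, p.2.1 i) :=
    continuous_fst.prodMk ((continuous_coord i).comp
      (continuous_subtype_val.comp continuous_snd))
  exact ContinuousAt.comp (x := (c, ⟨x, hx⟩)) (g := fun p : ℝ × Cadlag I => p.1 • p.2)
    (f := fun p : ℝ × {x : CadlagVec I ℓ // supNorm x < ∞} => (p.1, p.2.1 i)) (Cadlag.continuousAt_smul c (x i) hK) h1.continuousAt

end CadlagVec

/-! ### Measurability of polar coordinates and of the exceedance process. -/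

instance : SecondCountableTopology PosExt :=
  TopologicalSpace.Subtype.secondCountableTopology {r : ℝ≥0∞ | 0 < r}

instance [SecondCountableTopology (CadlagVec I ℓ)] : SecondCountableTopology (UnitSphere I ℓ) :=
  TopologicalSpace.Subtype.secondCountableTopology {x : CadlagVec I ℓ | supNorm x = 1}

instance : TopologicalSpace.PseudoMetrizableSpace (UnitSphere I ℓ) :=
  TopologicalSpace.PseudoMetrizableSpace.subtype {x : CadlagVec I ℓ | supNorm x = 1}

lemma measurableSet_hasDirection : MeasurableSet {x : CadlagVec I ℓ | HasDirection x} :=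
  (measurable_supNorm measurableSet_Ioi).inter (measurable_supNorm measurableSet_Iio)

open Classical in
/-- The polar coordinates `(‖x‖, x / ‖x‖)`, with value `p₀` when they do not make sense. -/
noncomputable def polar (p₀ : PolarSpace I ℓ) (x : CadlagVec I ℓ) : PolarSpace I ℓ :=
  if h : HasDirection x then (⟨supNorm x, h.1⟩, direction x h) else p₀

lemma polar_of_hasDirection (p₀ : PolarSpace I ℓ) {x : CadlagVec I ℓ} (h : HasDirection x) :
    polar p₀ x = (⟨supNorm x, h.1⟩, direction x h) :=
  dif_pos h

/-- The direction is a continuous function of the pair `(1 / ‖x‖, x)`, which is measurable in `x`.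
Second countability makes the product σ-field of such pairs the Borel one. -/
lemma measurable_polar [SecondCountableTopology (CadlagVec I ℓ)] (p₀ : PolarSpace I ℓ) :
    Measurable (polar p₀) := by
  classical
  refine Measurable.dite (s := {x : CadlagVec I ℓ | HasDirection x})
    (f := fun x => (⟨supNorm x.1, x.2.1⟩, direction x.1 x.2)) (g := fun _ => p₀) ?_
    measurable_const measurableSet_hasDirection
  refine Measurable.prodMk ?_ ?_
  · exact (measurable_supNorm.comp measurable_subtype_coe).subtype_mk
  · refine Measurable.subtype_mk (f := fun x : {x : CadlagVec I ℓ | HasDirection x} =>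
      scale (supNorm x.1).toReal⁻¹ x.1) ?_
    refine continuous_scale.measurable.comp (f := fun x : {x : CadlagVec I ℓ | HasDirection x} =>
      ((supNorm x.1).toReal⁻¹, (⟨x.1, x.2.2⟩ : {x : CadlagVec I ℓ // supNorm x < ∞})))
      (Measurable.prodMk ?_ measurable_subtype_coe.subtype_mk)
    exact (measurable_supNorm.comp measurable_subtype_coe).ennreal_toReal.inv

/-- The point measure with unit masses at those `y i` with `b i`. -/
noncomputable def pointMeasure {m : ℕ} (p : Fin m → Bool × PolarSpace I ℓ) : BddFinMeasure I ℓ :=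
  ⟨∑ i, if (p i).1 then Measure.dirac (p i).2 else 0, fun B _ _ => by
    have : ∀ i, IsFiniteMeasure
        (if (p i).1 then Measure.dirac (p i).2 else (0 : Measure (PolarSpace I ℓ))) := fun i => by
      split <;> infer_instance
    exact measure_lt_top _ B⟩

open Classical in
lemma exceedances_eq_pointMeasure {m : ℕ} (p₀ : PolarSpace I ℓ) (x : Fin m → CadlagVec I ℓ) :
    exceedances x = pointMeasure fun i => (decide (HasDirection (x i)), polar p₀ (x i)) := by
  refine Subtype.ext ?_
  change ∑ i : Fin m, polarMass (x i) = ∑ i : Fin m, _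
  refine Finset.sum_congr rfl fun i _ => ?_
  by_cases h : HasDirection (x i) <;> simp [polarMass, polar, h]

section

variable [SecondCountableTopology (CadlagVec I ℓ)]

/-- Integrals of test functions are finite sums of continuous functions of the points. The Borel
σ-field on measures is thus handled through continuity, without generating it by evaluations; the
discrete factor `Bool` switches masses off without destroying continuity. -/
lemma continuous_pointMeasure {m : ℕ} :
    Continuous (pointMeasure : (Fin m → Bool × PolarSpace I ℓ) → BddFinMeasure I ℓ) := by
  refine continuous_induced_rng.2 (continuous_pi fun f => ?_)
  have h1 : (fun p : Fin m → Bool × PolarSpace I ℓ => ∫ q, f.1 q ∂(pointMeasure p).1) =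
      fun p => ∑ i, (if (p i).1 then (1 : ℝ) else 0) * f.1 (p i).2 := by
    funext p
    have h2 : ∀ i, IsFiniteMeasure
        (if (p i).1 then Measure.dirac (p i).2 else (0 : Measure (PolarSpace I ℓ))) := fun i => by
      split <;> infer_instance
    change ∫ q, f.1 q ∂(∑ i, if (p i).1 then Measure.dirac (p i).2 else 0) = _
    rw [integral_finsetSum_measure fun i _ => f.1.integrable _]
    refine Finset.sum_congr rfl fun i _ => ?_
    split_ifs
    · rw [integral_dirac' _ _ f.1.continuous.stronglyMeasurable, one_mul]
    · simp
  change Continuous fun p => ∫ q, f.1 q ∂(pointMeasure p).1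
  rw [h1]
  refine continuous_finsetSum _ fun i _ => ?_
  have h3 : Continuous fun b : Bool => if b then (1 : ℝ) else 0 := continuous_of_discreteTopology
  exact (h3.comp (continuous_fst.comp (continuous_apply i))).mul
    (f.1.continuous.comp (continuous_snd.comp (continuous_apply i)))

lemma measurable_exceedances {m : ℕ} (p₀ : PolarSpace I ℓ) {Ω : Type*} [MeasurableSpace Ω]
    {X : Fin m → Ω → CadlagVec I ℓ} (hX : ∀ i, Measurable (X i)) :
    Measurable fun ω => exceedances fun i => X i ω := by
  classical
  simp only [exceedances_eq_pointMeasure p₀]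
  refine continuous_pointMeasure.measurable.comp (measurable_pi_lambda _ fun i => ?_)
  refine Measurable.prodMk ?_ ((measurable_polar p₀).comp (hX i))
  have h1 : Measurable fun x : CadlagVec I ℓ => decide (HasDirection x) := by
    refine measurable_to_bool ?_
    convert measurableSet_hasDirection (I := I) (ℓ := ℓ) using 1
    ext x
    simp
  exact h1.comp (hX i)

end

/-! ### Convergence of counts of independent elements -/

/-- If `∑ᵢ z n i → Z` and the `z n i` are dominated by uniformly small numbers with bounded sums,
then `∏ᵢ (1 + z n i) → exp Z`. -/
lemma tendsto_prod_one_add_exp {ι : ℕ → Type*} [∀ n, Fintype (ι n)] {z : ∀ n, ι n → ℂ}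
    {b : ∀ n, ι n → ℝ} {Z : ℂ} {L : ℝ} (hzb : ∀ n i, ‖z n i‖ ≤ b n i)
    (hb : ∀ ε > 0, ∀ᶠ n in atTop, ∀ i, b n i ≤ ε)
    (hL : Tendsto (fun n => ∑ i, b n i) atTop (𝓝 L))
    (hZ : Tendsto (fun n => ∑ i, z n i) atTop (𝓝 Z)) :
    Tendsto (fun n => ∏ i, (1 + z n i)) atTop (𝓝 (Complex.exp Z)) := by
  -- Each error is at most `‖z‖ ^ 2`, so their sum is at most the largest `b n i` times the bounded
  -- sum of all of them.
  have h1 : Tendsto (fun n => ∑ i, (Complex.log (1 + z n i) - z n i)) atTop (𝓝 0) := by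
    rw [tendsto_zero_iff_norm_tendsto_zero, Metric.tendsto_nhds]
    intro ε hε
    have hL' : ∀ᶠ n in atTop, ∑ i, b n i < |L| + 1 :=
      hL.eventually_lt_const (by linarith [le_abs_self L])
    have hδ : 0 < min (1 / 2) (ε / 2 / (|L| + 1)) := by positivity
    filter_upwards [hL', hb _ hδ] with n hn hbn
    rw [Real.dist_eq, sub_zero, abs_norm]
    have h2 : ∀ i, ‖Complex.log (1 + z n i) - z n i‖ ≤ ε / 2 / (|L| + 1) * b n i := by
      intro i
      have h3 : ‖z n i‖ ≤ 1 / 2 := (hzb n i).trans ((hbn i).trans (min_le_left _ _))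
      have h4 : (1 - ‖z n i‖)⁻¹ ≤ 2 := by
        rw [inv_le_comm₀ (by linarith) two_pos]; linarith
      have h0 := norm_nonneg (z n i)
      have h5 : ‖Complex.log (1 + z n i) - z n i‖ ≤ ‖z n i‖ * ‖z n i‖ := by
        refine (Complex.norm_log_one_add_sub_self_le (by linarith)).trans ?_
        have := mul_le_mul_of_nonneg_left h4 (sq_nonneg ‖z n i‖)
        nlinarith
      exact h5.trans (mul_le_mul ((hzb n i).trans ((hbn i).trans (min_le_right _ _))) (hzb n i) h0
        (by positivity))
    calc ‖∑ i, (Complex.log (1 + z n i) - z n i)‖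
        ≤ ∑ i, ε / 2 / (|L| + 1) * b n i := (norm_sum_le _ _).trans (Finset.sum_le_sum fun i _ => h2 i)
      _ = ε / 2 / (|L| + 1) * ∑ i, b n i := by rw [Finset.mul_sum]
      _ ≤ ε / 2 / (|L| + 1) * (|L| + 1) := mul_le_mul_of_nonneg_left hn.le (by positivity)
      _ = ε / 2 := div_mul_cancel₀ _ (by positivity)
      _ < ε := by linarith
  have h2 : Tendsto (fun n => ∑ i, Complex.log (1 + z n i)) atTop (𝓝 Z) := by
    have := h1.add hZ
    rw [zero_add] at this
    refine this.congr fun n => ?_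
    rw [← Finset.sum_add_distrib]
    exact Finset.sum_congr rfl fun i _ => sub_add_cancel _ _
  refine (Complex.continuous_exp.tendsto Z |>.comp h2).congr' ?_
  filter_upwards [hb (1 / 2) (by norm_num)] with n hn
  rw [Function.comp_apply, Complex.exp_sum]
  refine Finset.prod_congr rfl fun i _ => Complex.exp_log fun h => ?_
  have h3 : z n i = -1 := by linear_combination h
  have h4 := (hzb n i).trans (hn i)
  rw [h3] at h4
  norm_num at h4

/-- The vector of the indicators of the sets `S j`. -/
noncomputable def indicatorVec {E : Type*} {r : ℕ} (S : Fin r → Set E) (x : E) :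
    EuclideanSpace ℝ (Fin r) :=
  WithLp.toLp 2 fun j => (S j).indicator 1 x

lemma measurable_indicatorVec {E : Type*} [MeasurableSpace E] {r : ℕ} {S : Fin r → Set E}
    (hS : ∀ j, MeasurableSet (S j)) : Measurable (indicatorVec S) :=
  (WithLp.measurable_toLp 2 _).comp
    (measurable_pi_lambda _ fun j => measurable_one.indicator (hS j))

/-- By disjointness at most one indicator is nonzero, so the exponential is linear in the
indicators, and its expectation needs only the probabilities of the sets. -/
lemma exp_inner_indicatorVec {E : Type*} {r : ℕ} {S : Fin r → Set E}
    (hd : Pairwise fun i j => Disjoint (S i) (S j)) (t : EuclideanSpace ℝ (Fin r)) (x : E) :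
    Complex.exp ((inner ℝ (indicatorVec S x) t : ℝ) * Complex.I) =
      1 + ∑ j, (S j).indicator (fun _ => Complex.exp (t j * Complex.I) - 1) x := by
  have h1 : (inner ℝ (indicatorVec S x) t : ℝ) = ∑ j, (S j).indicator (fun _ => t j) x := by
    rw [PiLp.inner_apply]
    refine Finset.sum_congr rfl fun j _ => ?_
    by_cases h : x ∈ S j <;> simp [indicatorVec, h]
  rw [h1]
  by_cases hx : ∃ j, x ∈ S j
  · obtain ⟨j, hj⟩ := hx
    have hk : ∀ k ≠ j, x ∉ S k := fun k hk h => Set.disjoint_left.1 (hd hk) h hj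
    rw [Finset.sum_eq_single j (fun k _ hkj => indicator_of_notMem (hk k hkj) _) (by simp),
      Finset.sum_eq_single j (fun k _ hkj => indicator_of_notMem (hk k hkj) _) (by simp),
      indicator_of_mem hj, indicator_of_mem hj]
    ring
  · push Not at hx
    rw [Finset.sum_eq_zero fun j _ => indicator_of_notMem (hx j) _,
      Finset.sum_eq_zero fun j _ => indicator_of_notMem (hx j) _]
    simp

lemma charFun_map_indicatorVec {E Ω : Type*} [MeasurableSpace E] [MeasurableSpace Ω]
    {P : Measure Ω} [IsProbabilityMeasure P] {X : Ω → E} (hX : Measurable X) {r : ℕ}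
    {S : Fin r → Set E} (hS : ∀ j, MeasurableSet (S j))
    (hd : Pairwise fun i j => Disjoint (S i) (S j)) (t : EuclideanSpace ℝ (Fin r)) :
    charFun (P.map fun ω => indicatorVec S (X ω)) t =
      1 + ∑ j, P.real (X ⁻¹' S j) * (Complex.exp (t j * Complex.I) - 1) := by
  have hm : Measurable fun ω => indicatorVec S (X ω) := (measurable_indicatorVec hS).comp hX
  rw [charFun_apply, integral_map hm.aemeasurable (by fun_prop)]
  simp_rw [exp_inner_indicatorVec hd]
  have hi : ∀ j, Integrable (fun ω => (S j).indicator
      (fun _ => Complex.exp (t j * Complex.I) - 1) (X ω)) P := fun j =>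
    (integrable_const (Complex.exp (t j * Complex.I) - 1)).indicator (hX (hS j))
  rw [integral_add (integrable_const _) (integrable_finsetSum _ fun j _ => hi j),
    integral_finsetSum _ fun j _ => hi j]
  congr 1
  · simp
  · refine Finset.sum_congr rfl fun j _ => ?_
    have : (fun ω => (S j).indicator (fun _ => Complex.exp (t j * Complex.I) - 1) (X ω)) =
        (X ⁻¹' S j).indicator fun _ => Complex.exp (t j * Complex.I) - 1 := rfl
    rw [this, integral_indicator_const _ (hX (hS j)), Complex.real_smul]

/-- Joint convergence of the counts of independent uniformly small elements in disjoint sets to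
independent Poisson variables, in the form of the portmanteau inequality for open sets. -/
lemma measure_le_liminf_counts {E : Type*} [MeasurableSpace E] {m : ℕ → ℕ}
    {Ω : ℕ → Type*} [∀ n, MeasurableSpace (Ω n)] {P : ∀ n, Measure (Ω n)}
    [∀ n, IsProbabilityMeasure (P n)] {X : ∀ n, Fin (m n) → Ω n → E}
    (hX : ∀ n i, Measurable (X n i)) (hind : ∀ n, iIndepFun (X n) (P n))
    {Ω' : Type*} [MeasurableSpace Ω'] {P' : Measure Ω'} [IsProbabilityMeasure P'] {r : ℕ}
    {S : Fin r → Set E} (hS : ∀ j, MeasurableSet (S j))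
    (hd : Pairwise fun i j => Disjoint (S i) (S j)) {c : Fin r → ℝ≥0}
    (hlim : ∀ j, Tendsto (fun n => ∑ i, (P n).real (X n i ⁻¹' S j)) atTop (𝓝 (c j)))
    (hsmall : ∀ j, ∀ ε > 0, ∀ᶠ n in atTop, ∀ i, (P n).real (X n i ⁻¹' S j) ≤ ε)
    {M : Fin r → Ω' → ℝ} (hM : ∀ j, AEMeasurable (M j) P') (hMind : iIndepFun M P')
    (hMlaw : ∀ j, P'.map (M j) = (poissonMeasure (c j)).map (fun k : ℕ => (k : ℝ)))
    {U : Set (Fin r → ℝ)} (hU : IsOpen U) :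
    P' {ω | (fun j => M j ω) ∈ U} ≤
      liminf (fun n => P n {ω | (fun j => ∑ i, (S j).indicator 1 (X n i ω)) ∈ U}) atTop := by
  have hVm : ∀ n, Measurable fun ω => ∑ i, indicatorVec S (X n i ω) := fun n =>
    Finset.measurable_fun_sum _ fun i _ => (measurable_indicatorVec hS).comp (hX n i)
  have hM' : AEMeasurable (fun ω => WithLp.toLp 2 fun j => M j ω) P' :=
    (WithLp.measurable_toLp 2 _).comp_aemeasurable (aemeasurable_pi_lambda _ hM)
  let Q : ℕ → ProbabilityMeasure (EuclideanSpace ℝ (Fin r)) := fun n =>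
    ⟨(P n).map fun ω => ∑ i, indicatorVec S (X n i ω),
      Measure.isProbabilityMeasure_map (hVm n).aemeasurable⟩
  let Q' : ProbabilityMeasure (EuclideanSpace ℝ (Fin r)) :=
    ⟨P'.map fun ω => WithLp.toLp 2 fun j => M j ω, Measure.isProbabilityMeasure_map hM'⟩
  have hQ : Tendsto Q atTop (𝓝 Q') := by
    refine ProbabilityMeasure.tendsto_of_tendsto_charFun fun t => ?_
    change Tendsto (fun n => charFun ((P n).map fun ω => ∑ i, indicatorVec S (X n i ω)) t) atTop
      (𝓝 (charFun (P'.map fun ω => WithLp.toLp 2 fun j => M j ω) t))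
    have h1 : ∀ n, charFun ((P n).map fun ω => ∑ i, indicatorVec S (X n i ω)) t =
        ∏ i, (1 + ∑ j, (P n).real (X n i ⁻¹' S j) * (Complex.exp (t j * Complex.I) - 1)) := by
      intro n
      have h2 := (hind n).comp (fun _ => indicatorVec S) fun _ => measurable_indicatorVec hS
      have h3 := iIndepFun.charFun_map_fun_sum_eq_prod
        (fun i => ((measurable_indicatorVec hS).comp (hX n i)).aemeasurable) h2
      rw [show (fun ω => ∑ i, indicatorVec S (X n i ω)) =
        fun ω => ∑ i, (indicatorVec S ∘ X n i) ω from rfl, h3, Finset.prod_apply]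
      exact Finset.prod_congr rfl fun i _ => charFun_map_indicatorVec (hX n i) hS hd t
    have h2 : charFun (P'.map fun ω => WithLp.toLp 2 fun j => M j ω) t =
        Complex.exp (∑ j, c j * (Complex.exp (t j * Complex.I) - 1)) := by
      rw [(iIndepFun_iff_charFun_pi hM).1 hMind t, Complex.exp_sum]
      refine Finset.prod_congr rfl fun j _ => ?_
      rw [hMlaw j, charFun_map_cast_poissonMeasure]
    rw [h2]
    simp_rw [h1]
    -- The factor `2` bounds `|exp (i t) - 1|`.
    refine tendsto_prod_one_add_exp (b := fun n i => ∑ j, 2 * (P n).real (X n i ⁻¹' S j))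
      (L := ∑ j, 2 * (c j : ℝ)) (fun n i => ?_) (fun ε hε => ?_) ?_ ?_
    · refine (norm_sum_le _ _).trans (Finset.sum_le_sum fun j _ => ?_)
      rw [norm_mul, mul_comm, Complex.norm_real, Real.norm_of_nonneg measureReal_nonneg]
      refine mul_le_mul_of_nonneg_right ?_ measureReal_nonneg
      refine (norm_sub_le _ _).trans ?_
      rw [Complex.norm_exp_ofReal_mul_I, norm_one]
      norm_num
    -- With `r + 1` instead of `r`, the case `r = 0` needs no exception.
    · have h3 := eventually_all.2 fun j => hsmall j (ε / (2 * (r + 1))) (by positivity)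
      filter_upwards [h3] with n hn i
      calc ∑ j, 2 * (P n).real (X n i ⁻¹' S j)
          ≤ ∑ _j : Fin r, 2 * (ε / (2 * (r + 1))) :=
            Finset.sum_le_sum fun j _ => mul_le_mul_of_nonneg_left (hn j i) two_pos.le
        _ = ε * (r / (r + 1)) := by
            rw [Finset.sum_const, Finset.card_univ, Fintype.card_fin, nsmul_eq_mul]
            field_simp
        _ ≤ ε * 1 := mul_le_mul_of_nonneg_left
            ((div_le_one (by positivity)).2 (by linarith)) hε.le
        _ = ε := mul_one ε
    · simp_rw [Finset.sum_comm (s := Finset.univ (α := Fin (m _))), ← Finset.mul_sum]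
      exact (tendsto_finsetSum _ fun j _ => hlim j).const_mul 2
    · simp_rw [Finset.sum_comm (s := Finset.univ (α := Fin (m _))), ← Finset.sum_mul]
      refine tendsto_finsetSum _ fun j _ => Tendsto.mul_const _ ?_
      have := (Complex.continuous_ofReal.tendsto _).comp (hlim j)
      simpa [Function.comp_def] using this
  have hU' : IsOpen ((WithLp.ofLp : EuclideanSpace ℝ (Fin r) → Fin r → ℝ) ⁻¹' U) :=
    hU.preimage (PiLp.continuous_ofLp 2 _)
  have h1 := ProbabilityMeasure.le_liminf_measure_open_of_tendsto hQ hU'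
  have h2 : ∀ n, (Q n : Measure _) ((WithLp.ofLp : EuclideanSpace ℝ (Fin r) → Fin r → ℝ) ⁻¹' U) =
      P n {ω | (fun j => ∑ i, (S j).indicator 1 (X n i ω)) ∈ U} := by
    intro n
    change (P n).map (fun ω => ∑ i, indicatorVec S (X n i ω)) _ = _
    rw [Measure.map_apply (hVm n) hU'.measurableSet]
    congr 1
    ext ω
    have : WithLp.ofLp (∑ i, indicatorVec S (X n i ω)) =
        fun j => ∑ i, (S j).indicator 1 (X n i ω) := by
      funext j
      simp [indicatorVec]
    rw [mem_preimage, mem_preimage, this, mem_ofPred_eq]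
  simp_rw [h2] at h1
  refine le_trans (le_of_eq ?_) h1
  change _ = P'.map (fun ω => WithLp.toLp 2 fun j => M j ω) _
  rw [Measure.map_apply_of_aemeasurable hM' hU'.measurableSet]
  rfl

/-! ### The mean measure -/

/-- The set `(x, ∞] × A`. -/
def polarRect (x : ℝ) (A : Set (UnitSphere I ℓ)) : Set (PolarSpace I ℓ) :=
  {r : PosExt | ENNReal.ofReal x < r} ×ˢ A

lemma measurableSet_polarRect (x : ℝ) {A : Set (UnitSphere I ℓ)} (hA : MeasurableSet A) :
    MeasurableSet (polarRect x A) :=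
  (measurable_subtype_coe measurableSet_Ioi).prod hA

lemma radialMeasure_Ioi {α : ℝ} (hα : 0 < α) {x : ℝ} (hx : 0 < x) :
    radialMeasure α {r : PosExt | ENNReal.ofReal x < r} = ENNReal.ofReal (x ^ (-α)) := by
  have h1 : (Subtype.val '' {r : PosExt | ENNReal.ofReal x < r} : Set ℝ≥0∞) =
      Ioi (ENNReal.ofReal x) := by
    ext r
    refine ⟨?_, fun h => ⟨⟨r, pos_of_gt (mem_Ioi.1 h)⟩, h, rfl⟩⟩
    rintro ⟨r, h, rfl⟩
    exact h
  have h2 : ENNReal.ofReal ⁻¹' Ioi (ENNReal.ofReal x) = Ioi x := by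
    ext y
    exact ENNReal.ofReal_lt_ofReal_iff_of_nonneg hx.le
  have h3 : Ioi x ∩ Ioi (0 : ℝ) = Ioi x := inter_eq_left.2 (Ioi_subset_Ioi hx.le)
  have h4 : -α - 1 < -1 := by linarith
  refine ((MeasurableEmbedding.subtype_coe (s := {r : ℝ≥0∞ | 0 < r})
    measurableSet_Ioi).comap_apply _ _).trans ((congrArg _ h1).trans ?_)
  rw [Measure.map_apply ENNReal.measurable_ofReal measurableSet_Ioi, h2,
    withDensity_apply _ measurableSet_Ioi, Measure.restrict_restrict measurableSet_Ioi, h3,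
    ← ofReal_integral_eq_lintegral_ofReal ((integrableOn_Ioi_rpow_of_lt h4 hx).const_mul α)]
  · rw [integral_const_mul, integral_Ioi_rpow_of_lt h4 hx]
    congr 1
    rw [sub_add_cancel]
    field_simp
  · refine (ae_restrict_iff' measurableSet_Ioi).2 (ae_of_all _ fun y hy => ?_)
    exact mul_nonneg hα.le (Real.rpow_nonneg (hx.le.trans (le_of_lt hy)) _)

lemma polarMean_polarRect {α : ℝ} (hα : 0 < α) (ν : Measure (UnitSphere I ℓ)) [SFinite ν] {x : ℝ}
    (hx : 0 < x) (A : Set (UnitSphere I ℓ)) :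
    polarMean α ν (polarRect x A) = ENNReal.ofReal (x ^ (-α)) * ν A := by
  rw [polarMean, polarRect, Measure.prod_prod, radialMeasure_Ioi hα hx]

/-! ### Convergence on rings of sets -/

section Ring

variable {Y : Type*}

/-- The sets whose indicator functions are linear combinations of those of sets in `𝒢`. -/
def indicatorRing (𝒢 : Set (Set Y)) : Set (Set Y) :=
  {C | C.indicator 1 ∈ Submodule.span ℝ ((fun R : Set Y => R.indicator (1 : Y → ℝ)) '' 𝒢)}

lemma subset_indicatorRing (𝒢 : Set (Set Y)) : 𝒢 ⊆ indicatorRing 𝒢 := fun R hR =>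
  Submodule.subset_span ⟨R, hR, rfl⟩

lemma mul_mem_span_indicator {𝒢 : Set (Set Y)} (h𝒢 : ∀ R ∈ 𝒢, ∀ R' ∈ 𝒢, R ∩ R' ∈ 𝒢)
    {f g : Y → ℝ} (hf : f ∈ Submodule.span ℝ ((fun R : Set Y => R.indicator (1 : Y → ℝ)) '' 𝒢))
    (hg : g ∈ Submodule.span ℝ ((fun R : Set Y => R.indicator (1 : Y → ℝ)) '' 𝒢)) :
    f * g ∈ Submodule.span ℝ ((fun R : Set Y => R.indicator (1 : Y → ℝ)) '' 𝒢) := by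
  have h := Submodule.mul_mem_mul hf hg
  rw [Submodule.span_mul_span] at h
  refine Submodule.span_mono ?_ h
  rintro _ ⟨_, ⟨R, hR, rfl⟩, _, ⟨R', hR', rfl⟩, rfl⟩
  refine ⟨R ∩ R', h𝒢 R hR R' hR', ?_⟩
  exact inter_indicator_one

/-- Since `𝒢` is stable under intersections, the span of its indicators is stable under products,
and unions and differences are polynomial in indicators. -/
lemma isSetRing_indicatorRing {𝒢 : Set (Set Y)} (h𝒢 : ∀ R ∈ 𝒢, ∀ R' ∈ 𝒢, R ∩ R' ∈ 𝒢) :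
    IsSetRing (indicatorRing 𝒢) where
  empty_mem := by
    change (∅ : Set Y).indicator (1 : Y → ℝ) ∈ Submodule.span ℝ _
    rw [indicator_empty]
    exact Submodule.zero_mem _
  union_mem s t hs ht := by
    have h : (s ∪ t).indicator (1 : Y → ℝ) =
        s.indicator 1 + t.indicator 1 - s.indicator 1 * t.indicator 1 := by
      funext y
      by_cases h1 : y ∈ s <;> by_cases h2 : y ∈ t <;> simp [h1, h2]
    change (s ∪ t).indicator (1 : Y → ℝ) ∈ Submodule.span ℝ _
    rw [h]
    exact Submodule.sub_mem _ (Submodule.add_mem _ hs ht) (mul_mem_span_indicator h𝒢 hs ht)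
  sdiff_mem s t hs ht := by
    have h : (s \ t).indicator (1 : Y → ℝ) =
        s.indicator 1 - s.indicator 1 * t.indicator 1 := by
      funext y
      by_cases h1 : y ∈ s <;> by_cases h2 : y ∈ t <;> simp [h1, h2]
    change (s \ t).indicator (1 : Y → ℝ) ∈ Submodule.span ℝ _
    rw [h]
    exact Submodule.sub_mem _ hs (mul_mem_span_indicator h𝒢 hs ht)

lemma measurableSet_of_mem_indicatorRing [MeasurableSpace Y] {𝒢 : Set (Set Y)} (hm : ∀ R ∈ 𝒢, MeasurableSet R)
    {C : Set Y} (hC : C ∈ indicatorRing 𝒢) : MeasurableSet C := by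
  have h : Measurable (C.indicator (1 : Y → ℝ)) := by
    refine Submodule.span_induction (p := fun f _ => Measurable f) ?_ measurable_const
      (fun f g _ _ hf hg => hf.add hg) (fun c f _ hf => hf.const_smul c) hC
    rintro _ ⟨R, hR, rfl⟩
    exact measurable_one.indicator (hm R hR)
  have h2 : C = C.indicator (1 : Y → ℝ) ⁻¹' {1} := by
    ext y
    by_cases hy : y ∈ C <;> simp [hy]
  rw [h2]
  exact h (measurableSet_singleton 1)

lemma subset_of_mem_indicatorRing {𝒢 : Set (Set Y)} {ι : Type*} [LinearOrder ι] [Nonempty ι]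
    {T : ι → Set Y} (hT : Antitone T) (h : ∀ R ∈ 𝒢, ∃ x, R ⊆ T x)
    {C : Set Y} (hC : C ∈ indicatorRing 𝒢) : ∃ x, C ⊆ T x := by
  have h : ∃ x, Function.support (C.indicator (1 : Y → ℝ)) ⊆ T x := by
    refine Submodule.span_induction (p := fun f _ => ∃ x, Function.support f ⊆ T x) ?_
      ⟨Classical.arbitrary ι, by simp⟩ ?_ ?_ hC
    · rintro _ ⟨R, hR, rfl⟩
      obtain ⟨x, hx⟩ := h R hR
      exact ⟨x, support_indicator_subset.trans hx⟩
    · rintro f g - - ⟨x, hx⟩ ⟨y, hy⟩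
      refine ⟨min x y, (Function.support_add f g).trans (union_subset ?_ ?_)⟩
      · exact hx.trans (hT (min_le_left _ _))
      · exact hy.trans (hT (min_le_right _ _))
    · rintro c f - ⟨x, hx⟩
      exact ⟨x, (Function.support_const_smul_subset c f).trans hx⟩
  obtain ⟨x, hx⟩ := h
  refine ⟨x, fun y hy => hx ?_⟩
  simp [hy]

/-- Convergence of integrals is a linear condition, so it passes from the indicators of `𝒢` to their
span; this is why the ring is defined through a span. -/
lemma tendsto_of_mem_indicatorRing [MeasurableSpace Y] {𝒢 : Set (Set Y)} (hm : ∀ R ∈ 𝒢, MeasurableSet R)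
    {μs : ℕ → Measure Y} [∀ n, IsFiniteMeasure (μs n)] {μ : Measure Y} (hμ : ∀ R ∈ 𝒢, μ R ≠ ∞)
    (hlim : ∀ R ∈ 𝒢, Tendsto (fun n => μs n R) atTop (𝓝 (μ R)))
    {C : Set Y} (hC : C ∈ indicatorRing 𝒢) :
    Tendsto (fun n => (μs n).real C) atTop (𝓝 (μ.real C)) := by
  have h : Integrable (C.indicator (1 : Y → ℝ)) μ ∧
      (∀ n, Integrable (C.indicator (1 : Y → ℝ)) (μs n)) ∧
      Tendsto (fun n => ∫ y, C.indicator (1 : Y → ℝ) y ∂μs n) atTop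
        (𝓝 (∫ y, C.indicator (1 : Y → ℝ) y ∂μ)) := by
    refine Submodule.span_induction (p := fun f _ => Integrable f μ ∧
      (∀ n, Integrable f (μs n)) ∧ Tendsto (fun n => ∫ y, f y ∂μs n) atTop (𝓝 (∫ y, f y ∂μ)))
      ?_ ?_ ?_ ?_ hC
    · rintro _ ⟨R, hR, rfl⟩
      refine ⟨(integrable_indicator_iff (hm R hR)).2 (integrableOn_const (hμ R hR)), fun n =>
        (integrable_indicator_iff (hm R hR)).2 (integrableOn_const (measure_ne_top _ _)), ?_⟩
      simp only [integral_indicator_one (hm R hR)]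
      exact (ENNReal.tendsto_toReal (hμ R hR)).comp (hlim R hR)
    · simp
    · rintro f g - - ⟨h1, h2, h3⟩ ⟨h4, h5, h6⟩
      refine ⟨h1.add h4, fun n => (h2 n).add (h5 n), ?_⟩
      simp only [Pi.add_apply, integral_add h1 h4, integral_add (h2 _) (h5 _)]
      exact h3.add h6
    · rintro c f - ⟨h1, h2, h3⟩
      refine ⟨h1.smul c, fun n => (h2 n).smul c, ?_⟩
      simp only [Pi.smul_apply, integral_smul]
      exact h3.const_smul c
  have hCm := measurableSet_of_mem_indicatorRing hm hC
  simpa only [integral_indicator_one hCm] using h.2.2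

end Ring

/-! ### Atoms of a finite family of sets -/

section Atoms

variable {Y κ : Type*}

/-- The points that belong to exactly those `B k` with `k ∈ s`; empty if `s` is. -/
def atomSet (B : κ → Set Y) (s : Finset κ) : Set Y :=
  {y | s.Nonempty ∧ ∀ k, y ∈ B k ↔ k ∈ s}

/-- The atom of no index would be the complement of the union, which a ring need not contain; hence
the nonemptiness in `atomSet`. -/
lemma atomSet_mem [Fintype κ] [DecidableEq κ] {R : Set (Set Y)} (hR : IsSetRing R) {B : κ → Set Y} (hB : ∀ k, B k ∈ R)
    (s : Finset κ) : atomSet B s ∈ R := by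
  by_cases hs : s.Nonempty
  · have : atomSet B s = (⋂ k ∈ s, B k) \ ⋃ k ∈ sᶜ, B k := by
      ext y
      simp only [atomSet, hs, true_and, mem_ofPred_eq, Set.mem_sdiff, mem_iInter, mem_iUnion,
        Finset.mem_compl, exists_prop, not_exists, not_and]
      exact ⟨fun h => ⟨fun k hk => (h k).2 hk, fun k hk hy => hk ((h k).1 hy)⟩,
        fun h k => ⟨fun hy => by_contra fun hk => h.2 k hk hy, h.1 k⟩⟩
    rw [this]
    exact hR.sdiff_mem (hR.biInter_mem s hs fun k _ => hB k) (hR.biUnion_mem sᶜ fun k _ => hB k)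
  · have : atomSet B s = ∅ := by
      ext y
      simp [atomSet, hs]
    rw [this]
    exact hR.empty_mem

lemma disjoint_atomSet (B : κ → Set Y) {s t : Finset κ} (hst : s ≠ t) :
    Disjoint (atomSet B s) (atomSet B t) :=
  Set.disjoint_left.2 fun _ hs ht => hst (Finset.ext fun k => (hs.2 k).symm.trans (ht.2 k))

lemma biUnion_atomSet [Fintype κ] [DecidableEq κ] (B : κ → Set Y) (k : κ) :
    ⋃ s ∈ Finset.univ.filter (k ∈ ·), atomSet B s = B k := by
  classical
  ext y
  simp only [mem_iUnion, Finset.mem_filter, Finset.mem_univ, true_and, exists_prop]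
  constructor
  · rintro ⟨s, hk, hs⟩
    exact (hs.2 k).2 hk
  · intro hy
    refine ⟨Finset.univ.filter (y ∈ B ·), by simpa using hy, ⟨k, by simpa using hy⟩, fun k => ?_⟩
    simp

lemma measureReal_eq_sum_atomSet [Fintype κ] [DecidableEq κ] [MeasurableSpace Y] (μ : Measure Y) {B : κ → Set Y}
    (hm : ∀ s, MeasurableSet (atomSet B s)) (hμ : ∀ s, μ (atomSet B s) ≠ ∞) (k : κ) :
    (μ (B k)).toReal = ∑ s ∈ Finset.univ.filter (k ∈ ·), (μ (atomSet B s)).toReal := by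
  rw [← ENNReal.toReal_sum fun s _ => hμ s, ← measure_biUnion_finset
    (fun s _ t _ hst => disjoint_atomSet B hst) fun s _ => hm s, biUnion_atomSet]

end Atoms

/-! ### Continuity rectangles -/

/-- The sets `(x, ∞] × A` with `x > 0` and `A` a `ν`-continuity set. -/
def continuityRects (ν : Measure (UnitSphere I ℓ)) : Set (Set (PolarSpace I ℓ)) :=
  {R | ∃ x : ℝ, 0 < x ∧ ∃ A, MeasurableSet A ∧ ν (frontier A) = 0 ∧ R = polarRect x A}

lemma inter_mem_continuityRects (ν : Measure (UnitSphere I ℓ)) :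
    ∀ R ∈ continuityRects ν, ∀ R' ∈ continuityRects ν, R ∩ R' ∈ continuityRects ν := by
  rintro _ ⟨x, hx, A, hA, hνA, rfl⟩ _ ⟨y, hy, B, hB, hνB, rfl⟩
  refine ⟨max x y, lt_max_of_lt_left hx, A ∩ B, hA.inter hB, ?_, ?_⟩
  · refine measure_mono_null (frontier_inter_subset A B) (measure_union_null ?_ ?_)
    · exact measure_mono_null inter_subset_left hνA
    · exact measure_mono_null inter_subset_right hνB
  · ext p
    simp only [polarRect, mem_inter_iff, mem_prod, mem_ofPred_eq,
      (ENNReal.ofReal_mono.map_max : ENNReal.ofReal (max x y) = _), max_lt_iff]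
    tauto

lemma measurableSet_of_mem_continuityRects {ν : Measure (UnitSphere I ℓ)} :
    ∀ R ∈ continuityRects ν, MeasurableSet R := by
  rintro _ ⟨x, -, A, hA, -, rfl⟩
  exact measurableSet_polarRect x hA

/-- The ring generated by the continuity rectangles. -/
def continuityRing (ν : Measure (UnitSphere I ℓ)) : Set (Set (PolarSpace I ℓ)) :=
  indicatorRing (continuityRects ν)

lemma isSetRing_continuityRing (ν : Measure (UnitSphere I ℓ)) : IsSetRing (continuityRing ν) :=
  isSetRing_indicatorRing (inter_mem_continuityRects ν)

lemma polarRect_mem_continuityRing {ν : Measure (UnitSphere I ℓ)} {x : ℝ} (hx : 0 < x)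
    {A : Set (UnitSphere I ℓ)} (hA : MeasurableSet A) (hν : ν (frontier A) = 0) :
    polarRect x A ∈ continuityRing ν :=
  subset_indicatorRing _ ⟨x, hx, A, hA, hν, rfl⟩

lemma measurableSet_of_mem_continuityRing {ν : Measure (UnitSphere I ℓ)}
    {C : Set (PolarSpace I ℓ)} (hC : C ∈ continuityRing ν) : MeasurableSet C :=
  measurableSet_of_mem_indicatorRing measurableSet_of_mem_continuityRects hC

lemma exists_subset_polarRect {ν : Measure (UnitSphere I ℓ)} {C : Set (PolarSpace I ℓ)}
    (hC : C ∈ continuityRing ν) : ∃ x : ℝ, 0 < x ∧ C ⊆ polarRect x univ := by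
  obtain ⟨x, hx⟩ := subset_of_mem_indicatorRing (ι := Ioi (0 : ℝ))
    (T := fun x => polarRect x.1 univ) (fun x y hxy => prod_mono_left fun r hr =>
      (ENNReal.ofReal_le_ofReal hxy).trans_lt hr) (by
      rintro _ ⟨x, hx, A, -, -, rfl⟩
      exact ⟨⟨x, hx⟩, prod_mono_right (subset_univ A)⟩) hC
  exact ⟨x.1, x.2, hx⟩

lemma bddAwayFromZero_of_subset_polarRect {C : Set (PolarSpace I ℓ)} {x : ℝ} (hx : 0 < x)
    (hC : C ⊆ polarRect x univ) : BddAwayFromZero C :=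
  ⟨ENNReal.ofReal x, ENNReal.ofReal_pos.2 hx, fun _ hp => (hC hp).1.le⟩

lemma bddAwayFromZero_of_mem_continuityRing {ν : Measure (UnitSphere I ℓ)}
    {C : Set (PolarSpace I ℓ)} (hC : C ∈ continuityRing ν) : BddAwayFromZero C := by
  obtain ⟨x, hx, h⟩ := exists_subset_polarRect hC
  exact bddAwayFromZero_of_subset_polarRect hx h

/-- Around each point of a dense sequence, some radius between `1 / (n + 1)` and twice that has a
`ν`-null frontier. The lower bound makes the balls cover; the upper one keeps them within `3 / (n +
1)` of any point at distance less than `1 / (n + 1)` from the centre. -/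
lemma exists_seq_continuity_sets [SecondCountableTopology (CadlagVec I ℓ)]
    (ν : Measure (UnitSphere I ℓ)) [IsProbabilityMeasure ν] :
    ∃ A : ℕ → ℕ → Set (UnitSphere I ℓ), (∀ k n, MeasurableSet (A k n) ∧ ν (frontier (A k n)) = 0) ∧
      ∀ w, ∀ U ∈ 𝓝 w, ∃ k n, w ∈ A k n ∧ A k n ⊆ U := by
  let _ := TopologicalSpace.pseudoMetrizableSpacePseudoMetric (UnitSphere I ℓ)
  have : Nonempty (UnitSphere I ℓ) := ν.nonempty_of_neZero
  have h1 : ∀ k n : ℕ, ∃ r ∈ Ioo (1 / ((n : ℝ) + 1)) (2 * (1 / ((n : ℝ) + 1))),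
      ν (frontier (Metric.thickening r {TopologicalSpace.denseSeq (UnitSphere I ℓ) k})) = 0 :=
    fun k n => exists_null_frontier_thickening ν _
      (by linarith [Nat.one_div_pos_of_nat (α := ℝ) (n := n)])
  choose r hr hν using h1
  refine ⟨fun k n => Metric.thickening (r k n) {TopologicalSpace.denseSeq (UnitSphere I ℓ) k},
    fun k n => ⟨Metric.isOpen_thickening.measurableSet, hν k n⟩, fun w U hU => ?_⟩
  obtain ⟨ε, hε, hεU⟩ := Metric.mem_nhds_iff.1 hU
  obtain ⟨n, hn⟩ := exists_nat_one_div_lt (show 0 < ε / 3 by linarith)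
  obtain ⟨_, hk, k, rfl⟩ := Metric.dense_iff.1
    (TopologicalSpace.denseRange_denseSeq (UnitSphere I ℓ)) w _ (Nat.one_div_pos_of_nat (n := n))
  refine ⟨k, n, ?_, fun v hv => hεU ?_⟩
  · beta_reduce
    rw [Metric.thickening_singleton, Metric.mem_ball']
    exact (Metric.mem_ball.1 hk).trans (hr k n).1
  · beta_reduce at hv
    rw [Metric.thickening_singleton, Metric.mem_ball] at hv
    rw [Metric.mem_ball] at hk ⊢
    linarith [dist_triangle v (TopologicalSpace.denseSeq (UnitSphere I ℓ) k) w, (hr k n).2]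

/-- The intervals `(a, ∞]` and `(a, b]` are differences of the rays available in the ring. They need
not be open, so they give a network and not a base. -/
lemma exists_interval_nhds (r : PosExt) {U : Set PosExt} (hU : U ∈ 𝓝 r) :
    ∃ a : ℚ, (0 : ℝ) < a ∧ ENNReal.ofReal a < r ∧
      ((∀ s : PosExt, ENNReal.ofReal a < s → s ∈ U) ∨ ∃ b : ℚ, (0 : ℝ) < b ∧
        ¬ ENNReal.ofReal b < r ∧
        ∀ s : PosExt, ENNReal.ofReal a < s → ¬ ENNReal.ofReal b < s → s ∈ U) := by
  obtain ⟨V, hV, hVU'⟩ := mem_nhds_subtype _ _ _ |>.1 hU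
  have hVU : ∀ s : PosExt, (s : ℝ≥0∞) ∈ V → s ∈ U := fun s hs => hVU' hs
  have hr : 0 < (r : ℝ≥0∞) := r.2
  clear hVU' hU
  generalize (r : ℝ≥0∞) = r at hV hr ⊢
  induction r with
  | top =>
    obtain ⟨c, hc⟩ := ENNReal.nhds_top_basis.mem_iff.1 hV
    obtain ⟨a, ha⟩ := exists_rat_gt (max c.toReal 0)
    refine ⟨a, (le_max_right _ _).trans_lt ha, ENNReal.ofReal_lt_top, Or.inl fun s hs => ?_⟩
    refine hVU s (hc.2 (lt_trans ?_ hs))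
    exact (ENNReal.lt_ofReal_iff_toReal_lt hc.1.ne).2 ((le_max_left _ _).trans_lt ha)
  | coe ρ =>
    have hρ : (0 : ℝ) < ρ := by exact_mod_cast hr
    have h1 : ENNReal.ofReal ⁻¹' V ∈ 𝓝 (ρ : ℝ) :=
      ENNReal.continuous_ofReal.continuousAt.preimage_mem_nhds
        (by simpa using hV)
    obtain ⟨ε, hε, h⟩ := Metric.mem_nhds_iff.1 h1
    obtain ⟨a, ha, ha'⟩ := exists_rat_btwn (max_lt hρ (sub_lt_self (ρ : ℝ) hε))
    obtain ⟨b, hb, hb'⟩ := exists_rat_btwn (lt_add_of_pos_right (ρ : ℝ) hε)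
    have ha0 := (le_max_left _ _).trans_lt ha
    have ha1 := (le_max_right _ _).trans_lt ha
    have hρ' : ((ρ : ℝ≥0) : ℝ≥0∞) = ENNReal.ofReal ρ := by simp
    refine ⟨a, ha0, ?_, Or.inr ⟨b, hρ.trans hb, ?_, fun s hs hs' => hVU s ?_⟩⟩
    · rw [hρ']
      exact (ENNReal.ofReal_lt_ofReal_iff hρ).2 ha'
    · rw [hρ', not_lt]
      exact ENNReal.ofReal_le_ofReal hb.le
    · have hst : (s : ℝ≥0∞) ≠ ∞ := ne_top_of_le_ne_top ENNReal.ofReal_ne_top (not_lt.1 hs')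
      have h2 : (s : ℝ≥0∞) = ENNReal.ofReal (s : ℝ≥0∞).toReal := (ENNReal.ofReal_toReal hst).symm
      rw [h2, ENNReal.ofReal_lt_ofReal_iff_of_nonneg ha0.le] at hs
      rw [h2, ENNReal.ofReal_lt_ofReal_iff_of_nonneg (hρ.trans hb).le, not_lt] at hs'
      rw [h2]
      refine h (Metric.mem_ball.2 (abs_lt.2 ⟨?_, ?_⟩)) <;> linarith

/-- The continuity ring contains a countable network of the space. -/
lemma exists_network [SecondCountableTopology (CadlagVec I ℓ)]
    (ν : Measure (UnitSphere I ℓ)) [IsProbabilityMeasure ν] :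
    ∃ R : ℕ → Set (PolarSpace I ℓ), (∀ l, R l ∈ continuityRing ν) ∧
      ∀ p, ∀ U ∈ 𝓝 p, ∃ l, p ∈ R l ∧ R l ⊆ U := by
  classical
  obtain ⟨A, hA, hnet⟩ := exists_seq_continuity_sets ν
  have hR := isSetRing_continuityRing ν
  -- The empty set replaces rectangles that are not bounded away from zero, so that every `Q a k n`
  -- is in the ring.
  let Q : ℚ → ℕ → ℕ → Set (PolarSpace I ℓ) := fun a k n =>
    if (0 : ℝ) < a then polarRect a (A k n) else ∅
  have hQ : ∀ a k n, Q a k n ∈ continuityRing ν := by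
    intro a k n
    by_cases ha : (0 : ℝ) < a
    · rw [show Q a k n = polarRect a (A k n) from if_pos ha]
      exact polarRect_mem_continuityRing ha (hA k n).1 (hA k n).2
    · rw [show Q a k n = ∅ from if_neg ha]
      exact hR.empty_mem
  let R : ℚ × Option ℚ × ℕ × ℕ → Set (PolarSpace I ℓ) := fun c =>
    Q c.1 c.2.2.1 c.2.2.2 \ c.2.1.elim ∅ fun b => Q b c.2.2.1 c.2.2.2
  obtain ⟨e, he⟩ := exists_surjective_nat (ℚ × Option ℚ × ℕ × ℕ)
  refine ⟨R ∘ e, fun l => hR.sdiff_mem (hQ _ _ _) ?_, ?_⟩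
  · cases (e l).2.1 with
    | none => exact hR.empty_mem
    | some b => exact hQ _ _ _
  · rintro ⟨r, w⟩ U hU
    obtain ⟨V, hV, W, hW, hVW⟩ := mem_nhds_prod_iff.1 hU
    obtain ⟨k, n, hw, hkn⟩ := hnet w W hW
    obtain ⟨a, ha, har, h | ⟨b, hb, hbr, h⟩⟩ := exists_interval_nhds r hV
    · obtain ⟨l, hl⟩ := he (a, none, k, n)
      have h1 : (R ∘ e) l = polarRect a (A k n) := by
        simp only [R, Q, Function.comp_apply, hl, if_pos ha, Option.elim_none, sdiff_empty]
      refine ⟨l, ?_, ?_⟩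
      · rw [h1]; exact ⟨har, hw⟩
      · rw [h1]; exact fun p hp => hVW ⟨h _ hp.1, hkn hp.2⟩
    · obtain ⟨l, hl⟩ := he (a, some b, k, n)
      have h1 : (R ∘ e) l = polarRect a (A k n) \ polarRect b (A k n) := by
        simp only [R, Q, Function.comp_apply, hl, if_pos ha, if_pos hb, Option.elim_some]
      refine ⟨l, ?_, ?_⟩
      · rw [h1]; exact ⟨⟨har, hw⟩, fun h => hbr h.1⟩
      · rw [h1]
        exact fun p hp => hVW ⟨h _ hp.1.1 fun h' => hp.2 ⟨h', hp.1.2⟩, hkn hp.1.2⟩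

/-! ### Exceedances as counts -/

/-- The vectors whose polar coordinates lie in `C`. -/
def polarPreimage (C : Set (PolarSpace I ℓ)) : Set (CadlagVec I ℓ) :=
  {x | ∃ h : HasDirection x, ((⟨supNorm x, h.1⟩, direction x h) : PolarSpace I ℓ) ∈ C}

lemma polarPreimage_eq (p₀ : PolarSpace I ℓ) (C : Set (PolarSpace I ℓ)) :
    polarPreimage C = {x | HasDirection x} ∩ polar p₀ ⁻¹' C := by
  ext x
  refine ⟨?_, ?_⟩
  · rintro ⟨h, hC⟩
    exact ⟨h, by rwa [mem_preimage, polar_of_hasDirection p₀ h]⟩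
  · rintro ⟨h, hC⟩
    rw [mem_preimage, polar_of_hasDirection p₀ h] at hC
    exact ⟨h, hC⟩

lemma measurableSet_polarPreimage [SecondCountableTopology (CadlagVec I ℓ)]
    (p₀ : PolarSpace I ℓ) {C : Set (PolarSpace I ℓ)} (hC : MeasurableSet C) :
    MeasurableSet (polarPreimage C) := by
  rw [polarPreimage_eq p₀]
  exact measurableSet_hasDirection.inter (measurable_polar p₀ hC)

lemma disjoint_polarPreimage {C D : Set (PolarSpace I ℓ)} (h : Disjoint C D) :
    Disjoint (polarPreimage C) (polarPreimage D) :=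
  Set.disjoint_left.2 fun _ hx hx' => Set.disjoint_left.1 h hx.2 hx'.2

lemma polarMass_apply (x : CadlagVec I ℓ) {C : Set (PolarSpace I ℓ)} (hC : MeasurableSet C) :
    polarMass x C = (polarPreimage C).indicator 1 x := by
  classical
  by_cases h : HasDirection x
  · rw [polarMass, dif_pos h, Measure.dirac_apply' _ hC]
    by_cases h' : ((⟨supNorm x, h.1⟩, direction x h) : PolarSpace I ℓ) ∈ C
    · rw [indicator_of_mem h', indicator_of_mem (show x ∈ polarPreimage C from ⟨h, h'⟩)]
      rfl
    · rw [indicator_of_notMem h', indicator_of_notMem fun hx : x ∈ polarPreimage C => h' hx.2]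
  · rw [polarMass, dif_neg h, indicator_of_notMem fun hx : x ∈ polarPreimage C => h hx.1]
    rfl

lemma exceedances_apply {m : ℕ} (x : Fin m → CadlagVec I ℓ) {C : Set (PolarSpace I ℓ)}
    (hC : MeasurableSet C) :
    (exceedances x).1 C = ∑ i, (polarPreimage C).indicator 1 (x i) := by
  change (∑ i : Fin m, polarMass (x i)) C = _
  rw [Measure.finsetSum_apply]
  exact Finset.sum_congr rfl fun i _ => polarMass_apply (x i) hC

lemma toReal_exceedances_apply {m : ℕ} (x : Fin m → CadlagVec I ℓ) {C : Set (PolarSpace I ℓ)}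
    (hC : MeasurableSet C) :
    ((exceedances x).1 C).toReal = ∑ i, (polarPreimage C).indicator 1 (x i) := by
  rw [exceedances_apply x hC, ENNReal.toReal_sum]
  · refine Finset.sum_congr rfl fun i _ => ?_
    by_cases h : x i ∈ polarPreimage C <;> simp [h]
  · intro i _
    by_cases h : x i ∈ polarPreimage C <;> simp [h]

lemma exists_nat_exceedances_apply {m : ℕ} (x : Fin m → CadlagVec I ℓ) {C : Set (PolarSpace I ℓ)}
    (hC : MeasurableSet C) : ∃ k : ℕ, (exceedances x).1 C = k := by
  classical
  refine ⟨(Finset.univ.filter fun i => x i ∈ polarPreimage C).card, ?_⟩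
  rw [exceedances_apply x hC, Finset.card_filter, Nat.cast_sum]
  refine Finset.sum_congr rfl fun i _ => ?_
  by_cases h : x i ∈ polarPreimage C <;> simp [h]

/-! ### Neighbourhoods of integer-valued measures -/

/-- The cells `((1 / (q + 1), ∞] × S) ∩ R l \ ⋃_{j ∈ s} R j`; `R l` is omitted if `l` is `none`. -/
def networkCell (R : ℕ → Set (PolarSpace I ℓ)) (c : ℕ × Option ℕ × Finset ℕ) :
    Set (PolarSpace I ℓ) :=
  (polarRect (1 / ((c.1 : ℝ) + 1)) univ ∩ c.2.1.elim univ R) \ ⋃ j ∈ c.2.2, R j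

lemma networkCell_mem {ν : Measure (UnitSphere I ℓ)} {R : ℕ → Set (PolarSpace I ℓ)}
    (hR : ∀ l, R l ∈ continuityRing ν) (c : ℕ × Option ℕ × Finset ℕ) :
    networkCell R c ∈ continuityRing ν := by
  have h := isSetRing_continuityRing ν
  have h1 : polarRect (1 / ((c.1 : ℝ) + 1)) univ ∈ continuityRing ν :=
    polarRect_mem_continuityRing Nat.one_div_pos_of_nat MeasurableSet.univ (by simp)
  refine h.sdiff_mem ?_ (h.biUnion_mem _ fun j _ => hR j)
  cases c.2.1 with
  | none => simpa using h1
  | some l => exact h.inter_mem h1 (hR l)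

/-- If `f` has small oscillation on each of finitely many disjoint sets that carry both `μ` and
`μ'` and have the same mass, then the integrals of `f` are close to each other. -/
lemma abs_integral_sub_le {Y ι : Type*} [MeasurableSpace Y] {μ μ' : Measure Y} [IsFiniteMeasure μ]
    [IsFiniteMeasure μ'] {f : Y → ℝ} (hf : Integrable f μ) (hf' : Integrable f μ') {J : Finset ι}
    {D : ι → Set Y} (hD : ∀ j, MeasurableSet (D j))
    (hdisj : ∀ i ∈ J, ∀ j ∈ J, i ≠ j → Disjoint (D i) (D j))
    (hμ : μ (⋃ j ∈ J, D j)ᶜ = 0) (hμ' : μ' (⋃ j ∈ J, D j)ᶜ = 0)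
    (heq : ∀ j ∈ J, μ' (D j) = μ (D j)) {δ : ℝ}
    (hosc : ∀ j ∈ J, ∀ y ∈ D j, ∀ y' ∈ D j, |f y - f y'| ≤ δ) :
    |∫ y, f y ∂μ' - ∫ y, f y ∂μ| ≤ 2 * δ * μ.real univ := by
  have key : ∀ (ρ : Measure Y), IsFiniteMeasure ρ → Integrable f ρ → ρ (⋃ j ∈ J, D j)ᶜ = 0 →
      ∫ y, f y ∂ρ = ∑ j ∈ J, ∫ y in D j, f y ∂ρ := by
    intro ρ _ hfρ hρ
    rw [← integral_biUnion_finset J (fun j _ => hD j) (fun i hi j hj => hdisj i hi j hj)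
      fun j _ => hfρ.integrableOn]
    rw [← setIntegral_univ, setIntegral_congr_set]
    exact (ae_eq_univ.2 hρ).symm
  have hmass : μ.real univ = ∑ j ∈ J, μ.real (D j) := by
    rw [← measureReal_biUnion_finset (fun i hi j hj => hdisj i hi j hj) fun j _ => hD j]
    exact measureReal_congr (ae_eq_univ.2 hμ).symm
  have hcell : ∀ j ∈ J, |∫ y in D j, f y ∂μ' - ∫ y in D j, f y ∂μ| ≤ 2 * δ * μ.real (D j) := by
    intro j hj
    rcases (D j).eq_empty_or_nonempty with h | ⟨y₀, hy₀⟩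
    · simp [h]
    · have hb : ∀ ρ : Measure Y, IsFiniteMeasure ρ → Integrable f ρ →
          |∫ y in D j, f y ∂ρ - f y₀ * ρ.real (D j)| ≤ δ * ρ.real (D j) := by
        intro ρ _ hfρ
        have h1 : ∫ y in D j, f y ∂ρ - f y₀ * ρ.real (D j) = ∫ y in D j, (f y - f y₀) ∂ρ := by
          rw [integral_sub hfρ.integrableOn (integrable_const _), setIntegral_const, smul_eq_mul,
            mul_comm]
        rw [h1, ← Real.norm_eq_abs]
        exact norm_setIntegral_le_of_norm_le_const (measure_lt_top _ _)
          fun y hy => hosc j hj y hy y₀ hy₀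
      have h1 := hb μ inferInstance hf
      have h2 := hb μ' inferInstance hf'
      have h3 : μ'.real (D j) = μ.real (D j) := by rw [Measure.real, Measure.real, heq j hj]
      rw [h3] at h2
      have := abs_sub_le (∫ y in D j, f y ∂μ') (f y₀ * μ.real (D j)) (∫ y in D j, f y ∂μ)
      rw [abs_sub_comm (f y₀ * μ.real (D j))] at this
      linarith
  rw [key μ' inferInstance hf' hμ', key μ inferInstance hf hμ, ← Finset.sum_sub_distrib, hmass,
    Finset.mul_sum]
  exact (Finset.abs_sum_le_sum_abs _ _).trans (Finset.sum_le_sum hcell)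

/-- Only `μ` has to be integer-valued. One cell of the family is the uncovered remainder:
prescribing its mass to be zero forces `μ'` too to be carried, above the chosen level, by the
remaining cells. -/
lemma exists_finset_cell_of_mem_isOpen [SecondCountableTopology (CadlagVec I ℓ)]
    {R : ℕ → Set (PolarSpace I ℓ)} (hRm : ∀ l, MeasurableSet (R l))
    (hnet : ∀ p, ∀ U ∈ 𝓝 p, ∃ l, p ∈ R l ∧ R l ⊆ U) {G : Set (BddFinMeasure I ℓ)}
    (hG : IsOpen G) {μ : BddFinMeasure I ℓ} (hμG : μ ∈ G)
    (hint : ∀ B, MeasurableSet B → BddAwayFromZero B → ∃ k : ℕ, μ.1 B = k) :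
    ∃ F : Finset (ℕ × Option ℕ × Finset ℕ), ∀ μ' : BddFinMeasure I ℓ,
      (∀ c ∈ F, μ'.1 (networkCell R c) = μ.1 (networkCell R c)) → μ' ∈ G := by
  classical
  obtain ⟨O, hO, rfl⟩ := isOpen_induced_iff.1 hG
  obtain ⟨Φ, u, hu, hΦ⟩ := isOpen_pi_iff.1 hO _ hμG
  -- a common radius for the finitely many test functions
  have hε : ∃ ε > 0, ∀ f ∈ Φ, ∀ r : ℝ, |r - ∫ p, f.1 p ∂μ.1| < ε → r ∈ u f := by
    have h1 : ∀ f ∈ Φ, ∃ ε > 0, ∀ r : ℝ, |r - ∫ p, f.1 p ∂μ.1| < ε → r ∈ u f := fun f hf => by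
      obtain ⟨ε, hε, h⟩ := Metric.isOpen_iff.1 (hu f hf).1 _ (hu f hf).2
      exact ⟨ε, hε, fun r hr => h hr⟩
    choose! e he he' using h1
    rcases Φ.eq_empty_or_nonempty with rfl | hne
    · exact ⟨1, one_pos, by simp⟩
    · exact ⟨Φ.inf' hne e, (Finset.lt_inf'_iff _).2 he,
        fun f hf r hr => he' f hf r (hr.trans_le (Finset.inf'_le _ hf))⟩
  obtain ⟨ε, hε, hεu⟩ := hε
  -- a common level below which all test functions vanish
  have hq : ∃ q : ℕ, ∀ f ∈ Φ, Function.support f.1 ⊆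
      polarRect (I := I) (ℓ := ℓ) (1 / ((q : ℝ) + 1)) univ := by
    have h1 : ∀ f : BddSuppFun I ℓ, ∃ q : ℕ, ∀ q' ≥ q, Function.support f.1 ⊆
        polarRect (I := I) (ℓ := ℓ) (1 / ((q' : ℝ) + 1)) univ := fun f => by
      obtain ⟨η, hη, h⟩ := f.2
      obtain ⟨x, -, hx0, hx⟩ := ENNReal.lt_iff_exists_real_btwn.1 hη
      obtain ⟨q, hq⟩ := exists_nat_one_div_lt (ENNReal.ofReal_pos.1 hx0)
      refine ⟨q, fun q' hq' p hp => ⟨lt_of_le_of_lt (ENNReal.ofReal_le_ofReal ?_)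
        (hx.trans_le (h p hp)), mem_univ _⟩⟩
      refine le_trans ?_ hq.le
      have : (q : ℝ) ≤ q' := by exact_mod_cast hq'
      gcongr
    choose q hq using h1
    exact ⟨Φ.sup q, fun f hf => hq f _ (Finset.le_sup hf)⟩
  obtain ⟨q, hq⟩ := hq
  set T := polarRect (I := I) (ℓ := ℓ) (1 / ((q : ℝ) + 1)) univ with hT
  have hTm : MeasurableSet T := measurableSet_polarRect _ MeasurableSet.univ
  have hTb : BddAwayFromZero T :=
    bddAwayFromZero_of_subset_polarRect Nat.one_div_pos_of_nat subset_rfl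
  set K := μ.1.real T with hK
  have hK0 : 0 ≤ K := measureReal_nonneg
  -- Chosen so that `2 * δ * K < ε`, even if `K = 0`.
  set δ := ε / (2 * (K + 1)) / 2 with hδ
  have hδ0 : 0 < δ := by positivity
  let L : Set ℕ := {l | ∀ f ∈ Φ, ∀ y ∈ R l, ∀ y' ∈ R l, |f.1 y - f.1 y'| ≤ δ}
  have hcover : ∀ p, ∃ l ∈ L, p ∈ R l := by
    intro p
    have h1 : (⋂ f ∈ Φ, f.1 ⁻¹' Metric.ball (f.1 p) (δ / 2)) ∈ 𝓝 p :=
      (Finset.iInter_mem_sets Φ).2 fun f _ =>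
        f.1.continuous.continuousAt.preimage_mem_nhds (Metric.ball_mem_nhds _ (half_pos hδ0))
    obtain ⟨l, hpl, hl⟩ := hnet p _ h1
    refine ⟨l, fun f hf y hy y' hy' => ?_, hpl⟩
    have h2 : |f.1 y - f.1 p| < δ / 2 := mem_iInter₂.1 (hl hy) f hf
    have h3 : |f.1 y' - f.1 p| < δ / 2 := mem_iInter₂.1 (hl hy') f hf
    rw [abs_sub_comm] at h3
    linarith [abs_sub_le (f.1 y) (f.1 p) (f.1 y')]
  -- finitely many of the sets `R l`, `l ∈ L`, carry all the mass in `T`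
  let s : ℕ → Finset ℕ := fun n => (Finset.range n).filter (· ∈ L)
  have hlim : ∃ n, μ.1 (networkCell R (q, none, s n)) = 0 := by
    have h1 : Tendsto (fun n => μ.1 (networkCell R (q, none, s n))) atTop
        (𝓝 (μ.1 (⋂ n, networkCell R (q, none, s n)))) := by
      refine tendsto_measure_iInter_atTop (fun n => ?_) ?_ ⟨0, ?_⟩
      · exact ((hTm.inter MeasurableSet.univ).diff
          (Finset.measurableSet_biUnion _ fun l _ => hRm l)).nullMeasurableSet
      · intro a b hab
        refine sdiff_subset_sdiff_right (biUnion_subset_biUnion_left ?_)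
        exact Finset.filter_subset_filter _ (Finset.range_mono hab)
      · exact (measure_mono (sdiff_subset.trans inter_subset_left)).trans_lt (μ.2 T hTm hTb) |>.ne
    have h2 : ⋂ n, networkCell R (q, none, s n) = ∅ := by
      refine eq_empty_of_forall_notMem fun p hp => ?_
      obtain ⟨l, hl, hpl⟩ := hcover p
      refine (mem_iInter.1 hp (l + 1)).2 (mem_iUnion₂.2 ⟨l, ?_, hpl⟩)
      simp [s, hl]
    rw [h2, measure_empty] at h1
    -- Integrality enters here: once the remainder has mass below one, it has mass zero.
    obtain ⟨n, hn⟩ := (h1.eventually_lt_const one_pos).exists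
    refine ⟨n, ?_⟩
    obtain ⟨k, hk⟩ := hint (networkCell R (q, none, s n))
      ((hTm.inter MeasurableSet.univ).diff (Finset.measurableSet_biUnion _ fun l _ => hRm l))
      (bddAwayFromZero_of_subset_polarRect Nat.one_div_pos_of_nat
        (sdiff_subset.trans inter_subset_left))
    rw [hk] at hn ⊢
    have : k < 1 := by exact_mod_cast hn
    simp [Nat.lt_one_iff.1 this]
  obtain ⟨n, hn⟩ := hlim
  -- Removing the admissible sets of smaller index makes the cells disjoint. A covered point of `T`
  -- then lies in the cell of its least admissible index.
  let D : ℕ → Set (PolarSpace I ℓ) := fun l => networkCell R (q, some l, s l)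
  have hDm : ∀ l, MeasurableSet (D l) := fun l =>
    (hTm.inter (hRm l)).diff (Finset.measurableSet_biUnion _ fun l _ => hRm l)
  have hDT : ∀ l, D l ⊆ T := fun l => sdiff_subset.trans inter_subset_left
  have hDR : ∀ l, D l ⊆ R l := fun l => sdiff_subset.trans inter_subset_right
  have hdisj' : ∀ i j, i ∈ L → i < j → Disjoint (D i) (D j) := by
    intro i j hi hij
    refine Set.disjoint_left.2 fun p hp hp' => hp'.2 (mem_iUnion₂.2 ⟨i, ?_, hDR i hp⟩)
    simp [s, hi, hij]
  have hdisj : ∀ i ∈ s n, ∀ j ∈ s n, i ≠ j → Disjoint (D i) (D j) := by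
    intro i hi j hj hij
    rcases hij.lt_or_gt with h | h
    · exact hdisj' i j (Finset.mem_filter.1 hi).2 h
    · exact (hdisj' j i (Finset.mem_filter.1 hj).2 h).symm
  have hrest : T ∩ (⋃ l ∈ s n, D l)ᶜ ⊆ networkCell R (q, none, s n) := by
    rintro p ⟨hpT, hp⟩
    refine ⟨⟨hpT, mem_univ p⟩, fun h => ?_⟩
    have hex : ∃ l, l ∈ s n ∧ p ∈ R l := by
      obtain ⟨l, hl, hpl⟩ := mem_iUnion₂.1 h
      exact ⟨l, hl, hpl⟩
    obtain ⟨hl, hpl⟩ := Nat.find_spec hex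
    refine hp (mem_iUnion₂.2 ⟨Nat.find hex, hl, ⟨hpT, hpl⟩, fun h' => ?_⟩)
    obtain ⟨j, hj, hpj⟩ := mem_iUnion₂.1 h'
    have hj' := Finset.mem_filter.1 hj
    have hlt : j < Nat.find hex := Finset.mem_range.1 hj'.1
    have hln : Nat.find hex < n := Finset.mem_range.1 (Finset.mem_filter.1 hl).1
    exact Nat.find_min hex hlt
      ⟨Finset.mem_filter.2 ⟨Finset.mem_range.2 (hlt.trans hln), hj'.2⟩, hpj⟩
  refine ⟨insert (q, none, s n) ((s n).image fun l => (q, some l, s l)), fun μ' hμ' => ?_⟩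
  have h0 : μ'.1 (networkCell R (q, none, s n)) = 0 :=
    (hμ' _ (Finset.mem_insert_self _ _)).trans hn
  have heq : ∀ l ∈ s n, μ'.1 (D l) = μ.1 (D l) := fun l hl =>
    hμ' _ (Finset.mem_insert_of_mem (Finset.mem_image_of_mem _ hl))
  refine hΦ fun f hf => hεu f hf _ ?_
  have hset : ∀ ρ : Measure (PolarSpace I ℓ), ∫ p, f.1 p ∂ρ = ∫ p in T, f.1 p ∂ρ := fun ρ =>
    (setIntegral_eq_integral_of_forall_compl_eq_zero fun p hp =>
      by_contra fun h => hp (hq f hf h)).symm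
  have hfin : ∀ ρ : BddFinMeasure I ℓ, IsFiniteMeasure (ρ.1.restrict T) := fun ρ =>
    ⟨by rw [Measure.restrict_apply_univ]; exact ρ.2 T hTm hTb⟩
  have := hfin μ
  have := hfin μ'
  have hD : ∀ ρ : Measure (PolarSpace I ℓ), ∀ l, ρ.restrict T (D l) = ρ (D l) := fun ρ l => by
    rw [Measure.restrict_apply (hDm l), inter_eq_left.2 (hDT l)]
  have hnull : ∀ ρ : Measure (PolarSpace I ℓ), ρ (networkCell R (q, none, s n)) = 0 →
      ρ.restrict T (⋃ l ∈ s n, D l)ᶜ = 0 := fun ρ hρ => by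
    rw [Measure.restrict_apply' hTm, inter_comm]
    exact measure_mono_null hrest hρ
  change |∫ p, f.1 p ∂μ'.1 - ∫ p, f.1 p ∂μ.1| < ε
  rw [hset μ'.1, hset μ.1]
  refine (abs_integral_sub_le (f.1.integrable _) (f.1.integrable _) hDm hdisj (hnull _ hn)
    (hnull _ h0) (fun l hl => by rw [hD, hD, heq l hl])
    fun l hl y hy y' hy' => (Finset.mem_filter.1 hl).2 f hf y (hDR l hy) y' (hDR l hy')).trans_lt ?_
  have h1 : (μ.1.restrict T).real univ = K := by
    rw [measureReal_restrict_apply MeasurableSet.univ, univ_inter]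
  rw [h1, hδ]
  have h2 : 2 * (ε / (2 * (K + 1)) / 2) * K = ε * (K / (2 * (K + 1))) := by field_simp
  rw [h2]
  refine mul_lt_of_lt_one_right hε ((div_lt_one (by positivity)).2 (by linarith))

/-! ### Convergence of the exceedances -/

lemma eventually_measureReal_polarPreimage_le {m : ℕ → ℕ} {Ω : ℕ → Type*}
    [∀ n, MeasurableSpace (Ω n)] {P : ∀ n, Measure (Ω n)} {X : ∀ n, Fin (m n) → Ω n → CadlagVec I ℓ}
    {ν : Measure (UnitSphere I ℓ)} {C : Set (PolarSpace I ℓ)}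
    (h_sup : ∀ x : ℝ, 0 < x →
      Tendsto (fun n => ⨆ i, P n {ω | ENNReal.ofReal x < (X n i ω).supNorm}) atTop (𝓝 0))
    (hC : C ∈ continuityRing ν) {ε : ℝ} (hε : 0 < ε) :
    ∀ᶠ n in atTop, ∀ i, (P n).real (X n i ⁻¹' polarPreimage C) ≤ ε := by
  obtain ⟨x, hx, hCx⟩ := exists_subset_polarRect hC
  filter_upwards [(h_sup x hx).eventually_lt_const (ENNReal.ofReal_pos.2 hε)] with n hn i
  refine ENNReal.toReal_le_of_le_ofReal hε.le (le_trans (measure_mono ?_)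
    ((le_iSup (fun i => P n {ω | ENNReal.ofReal x < (X n i ω).supNorm}) i).trans hn.le))
  rintro ω ⟨h, hω⟩
  exact (hCx hω).1

section Convergence

variable [SecondCountableTopology (CadlagVec I ℓ)] {m : ℕ → ℕ} {Ω : ℕ → Type*}
  [∀ n, MeasurableSpace (Ω n)] {P : ∀ n, Measure (Ω n)} [∀ n, IsProbabilityMeasure (P n)]
  {X : ∀ n, Fin (m n) → Ω n → CadlagVec I ℓ} {α : ℝ} {ν : Measure (UnitSphere I ℓ)}
  [IsProbabilityMeasure ν] {C : Set (PolarSpace I ℓ)}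

lemma tendsto_sum_measureReal_polarPreimage (p₀ : PolarSpace I ℓ) (hα : 0 < α)
    (hX : ∀ n i, Measurable (X n i))
    (h_lim : ∀ x : ℝ, 0 < x → ∀ A : Set (UnitSphere I ℓ), MeasurableSet A → ν (frontier A) = 0 →
      Tendsto
        (fun n => ∑ i, P n {ω | ENNReal.ofReal x < (X n i ω).supNorm ∧
          ∃ h : HasDirection (X n i ω), direction (X n i ω) h ∈ A})
        atTop (𝓝 (ENNReal.ofReal (x ^ (-α)) * ν A)))
    (hC : C ∈ continuityRing ν) :
    Tendsto (fun n => ∑ i, (P n).real (X n i ⁻¹' polarPreimage C)) atTop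
      (𝓝 ((polarMean α ν).real C)) := by
  -- The mean measure of the exceedances; it is finite because there are finitely many terms.
  let μs : ℕ → Measure (PolarSpace I ℓ) := fun n =>
    ∑ i, (((P n).map (X n i)).restrict {x | HasDirection x}).map (polar p₀)
  have hμs : ∀ n {D : Set (PolarSpace I ℓ)}, MeasurableSet D →
      μs n D = ∑ i, P n (X n i ⁻¹' polarPreimage D) := by
    intro n D hD
    rw [Measure.finsetSum_apply]
    refine Finset.sum_congr rfl fun i _ => ?_
    rw [Measure.map_apply (measurable_polar p₀) hD,
      Measure.restrict_apply (measurable_polar p₀ hD), inter_comm, ← polarPreimage_eq,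
      Measure.map_apply (hX n i) (measurableSet_polarPreimage p₀ hD)]
  have hfin : ∀ n, IsFiniteMeasure (μs n) := fun n =>
    ⟨by
      rw [hμs n MeasurableSet.univ]
      exact ENNReal.sum_lt_top.2 fun i _ => measure_lt_top _ _⟩
  have h1 := tendsto_of_mem_indicatorRing (μs := μs) (μ := polarMean α ν)
    measurableSet_of_mem_continuityRects ?_ ?_ hC
  · refine h1.congr fun n => ?_
    rw [Measure.real, hμs n (measurableSet_of_mem_continuityRing hC),
      ENNReal.toReal_sum fun i _ => measure_ne_top _ _]
    rfl
  · rintro _ ⟨x, hx, A, -, -, rfl⟩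
    rw [polarMean_polarRect hα ν hx]
    exact ENNReal.mul_ne_top ENNReal.ofReal_ne_top (measure_ne_top _ _)
  · rintro _ ⟨x, hx, A, hA, hνA, rfl⟩
    rw [polarMean_polarRect hα ν hx]
    refine (h_lim x hx A hA hνA).congr fun n => ?_
    rw [hμs n (measurableSet_polarRect x hA)]
    refine Finset.sum_congr rfl fun i _ => congrArg _ ?_
    ext ω
    exact ⟨fun ⟨h1, h, h2⟩ => ⟨h, h1, h2⟩, fun ⟨h, h1, h2⟩ => ⟨h1, h, h2⟩⟩

/-- Joint convergence of the numbers of exceedances in finitely many sets of the continuity ring,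
in the form of the portmanteau inequality for open sets. -/
lemma measure_le_liminf_exceedances (p₀ : PolarSpace I ℓ) (hα : 0 < α)
    (hX : ∀ n i, Measurable (X n i)) (hX_indep : ∀ n, iIndepFun (X n) (P n))
    (h_lim : ∀ x : ℝ, 0 < x → ∀ A : Set (UnitSphere I ℓ), MeasurableSet A → ν (frontier A) = 0 →
      Tendsto
        (fun n => ∑ i, P n {ω | ENNReal.ofReal x < (X n i ω).supNorm ∧
          ∃ h : HasDirection (X n i ω), direction (X n i ω) h ∈ A})
        atTop (𝓝 (ENNReal.ofReal (x ^ (-α)) * ν A)))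
    (h_sup : ∀ x : ℝ, 0 < x →
      Tendsto (fun n => ⨆ i, P n {ω | ENNReal.ofReal x < (X n i ω).supNorm}) atTop (𝓝 0))
    {Ω' : Type*} [MeasurableSpace Ω'] {P' : Measure Ω'} [IsProbabilityMeasure P']
    {N : Ω' → BddFinMeasure I ℓ} (hN : IsPoissonPointProcess P' N (polarMean α ν))
    {κ : Type*} [Fintype κ] {B : κ → Set (PolarSpace I ℓ)} (hB : ∀ k, B k ∈ continuityRing ν)
    {U : Set (κ → ℝ)} (hU : IsOpen U) :
    P' {ω | (fun k => ((N ω).1 (B k)).toReal) ∈ U} ≤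
      liminf (fun n => P n {ω | (fun k => ((exceedances fun i => X n i ω).1 (B k)).toReal) ∈ U})
        atTop := by
  classical
  let e := Fintype.equivFin (Finset κ)
  let A : Fin (Fintype.card (Finset κ)) → Set (PolarSpace I ℓ) := fun j => atomSet B (e.symm j)
  have hatom : ∀ s, atomSet B s ∈ continuityRing ν :=
    atomSet_mem (isSetRing_continuityRing ν) hB
  have hA : ∀ j, A j ∈ continuityRing ν := fun j => hatom _
  have hAm : ∀ j, MeasurableSet (A j) := fun j => measurableSet_of_mem_continuityRing (hA j)
  have hAb : ∀ j, BddAwayFromZero (A j) := fun j => bddAwayFromZero_of_mem_continuityRing (hA j)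
  have hAd : Pairwise fun i j => Disjoint (A i) (A j) := fun i j hij =>
    disjoint_atomSet B (e.symm.injective.ne hij)
  -- The linear map that recovers the masses of the `B k` from those of their disjoint atoms.
  let ψ : (Fin (Fintype.card (Finset κ)) → ℝ) → κ → ℝ := fun v k =>
    ∑ s ∈ Finset.univ.filter (k ∈ ·), v (e s)
  have hψ : Continuous ψ := continuous_pi fun k => continuous_finsetSum _ fun s _ =>
    continuous_apply (e s)
  have hsum : ∀ ρ : BddFinMeasure I ℓ,
      (fun k => (ρ.1 (B k)).toReal) = ψ fun j => (ρ.1 (A j)).toReal := by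
    intro ρ
    funext k
    rw [measureReal_eq_sum_atomSet ρ.1
      (fun s => measurableSet_of_mem_continuityRing (hatom s))
      (fun s => (ρ.2 _ (measurableSet_of_mem_continuityRing (hatom s))
        (bddAwayFromZero_of_mem_continuityRing (hatom s))).ne) k]
    simp [ψ, A]
  -- Measurability is read off from the law: the image measure under a map that is not a.e.
  -- measurable is zero by convention, whereas the Poisson law has mass one.
  have hNm : ∀ j, AEMeasurable (fun ω => (N ω).1 (A j)) P' := by
    intro j
    by_contra h
    have h1 := hN.poisson (A j) (hAm j) (hAb j)
    rw [Measure.map_of_not_aemeasurable h] at h1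
    have h2 := congrArg (fun ρ => ρ univ) h1
    rw [Measure.map_apply measurable_from_top MeasurableSet.univ] at h2
    simp at h2
  have key := measure_le_liminf_counts (P' := P') hX hX_indep
    (S := fun j => polarPreimage (A j)) (fun j => measurableSet_polarPreimage p₀ (hAm j))
    (fun i j hij => disjoint_polarPreimage (hAd hij))
    (c := fun j => (polarMean α ν (A j)).toNNReal)
    (fun j => tendsto_sum_measureReal_polarPreimage p₀ hα hX h_lim (hA j))
    (fun j ε hε => eventually_measureReal_polarPreimage_le h_sup (hA j) hε)
    (M := fun j ω => ((N ω).1 (A j)).toReal) (fun j => (hNm j).ennreal_toReal)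
    ((hN.indep _ A hAm hAb hAd).comp (fun _ => ENNReal.toReal) fun _ => ENNReal.measurable_toReal)
    (fun j => by
      have h1 : (fun ω => ((N ω).1 (A j)).toReal) = ENNReal.toReal ∘ fun ω => (N ω).1 (A j) := rfl
      rw [h1, ← AEMeasurable.map_map_of_aemeasurable ENNReal.measurable_toReal.aemeasurable (hNm j),
        hN.poisson (A j) (hAm j) (hAb j), Measure.map_map ENNReal.measurable_toReal
          measurable_from_top]
      congr 1)
    (hU.preimage hψ)
  simp only [hsum]
  simp only [toReal_exceedances_apply _ (hAm _)]
  exact key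

/-- The portmanteau inequality for the exceedances. -/
lemma measure_preimage_le_liminf_exceedances (hα : 0 < α)
    (hX : ∀ n i, Measurable (X n i)) (hX_indep : ∀ n, iIndepFun (X n) (P n))
    (h_lim : ∀ x : ℝ, 0 < x → ∀ A : Set (UnitSphere I ℓ), MeasurableSet A → ν (frontier A) = 0 →
      Tendsto
        (fun n => ∑ i, P n {ω | ENNReal.ofReal x < (X n i ω).supNorm ∧
          ∃ h : HasDirection (X n i ω), direction (X n i ω) h ∈ A})
        atTop (𝓝 (ENNReal.ofReal (x ^ (-α)) * ν A)))
    (h_sup : ∀ x : ℝ, 0 < x →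
      Tendsto (fun n => ⨆ i, P n {ω | ENNReal.ofReal x < (X n i ω).supNorm}) atTop (𝓝 0))
    {Ω' : Type*} [MeasurableSpace Ω'] {P' : Measure Ω'} [IsProbabilityMeasure P']
    {N : Ω' → BddFinMeasure I ℓ} (hN : IsPoissonPointProcess P' N (polarMean α ν))
    {G : Set (BddFinMeasure I ℓ)} (hG : IsOpen G) :
    P' (N ⁻¹' G) ≤ liminf (fun n => P n ((fun ω => exceedances fun i => X n i ω) ⁻¹' G)) atTop := by
  classical
  obtain ⟨w₀⟩ : Nonempty (UnitSphere I ℓ) := ν.nonempty_of_neZero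
  let p₀ : PolarSpace I ℓ := (⟨1, one_pos⟩, w₀)
  obtain ⟨R, hR, hnet⟩ := exists_network ν
  have hcell := networkCell_mem hR
  -- the event that prescribes the masses of finitely many cells
  let ev : Finset ((ℕ × Option ℕ × Finset ℕ) × ℕ) → Set (BddFinMeasure I ℓ) := fun E =>
    {μ | ∀ c ∈ E, μ.1 (networkCell R c.1) = c.2}
  -- The index set is countable, so finite unions of these events exhaust the mass of the whole
  -- union.
  let f : Finset ((ℕ × Option ℕ × Finset ℕ) × ℕ) → Set Ω' := fun E =>
    if ev E ⊆ G then N ⁻¹' ev E else ∅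
  have hcov : P' (N ⁻¹' G) ≤ P' (⋃ E, f E) := by
    refine measure_mono_ae ?_
    filter_upwards [hN.point_measure] with ω hω hωG
    obtain ⟨F, hF⟩ := exists_finset_cell_of_mem_isOpen
      (fun l => measurableSet_of_mem_continuityRing (hR l)) hnet hG hωG hω
    choose k hk using fun c => hω (networkCell R c) (measurableSet_of_mem_continuityRing (hcell c))
      (bddAwayFromZero_of_mem_continuityRing (hcell c))
    refine mem_iUnion.2 ⟨F.image fun c => (c, k c), ?_⟩
    have h1 : ev (F.image fun c => (c, k c)) ⊆ G := fun μ' hμ' => hF μ' fun c hc => by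
      rw [hk c]
      exact hμ' (c, k c) (Finset.mem_image_of_mem (fun c => (c, k c)) hc)
    rw [show f _ = N ⁻¹' ev (F.image fun c => (c, k c)) from if_pos h1]
    intro c hc
    obtain ⟨c, -, rfl⟩ := Finset.mem_image.1 hc
    exact hk c
  refine hcov.trans ?_
  have hmono : Monotone fun 𝓕 : Finset (Finset ((ℕ × Option ℕ × Finset ℕ) × ℕ)) =>
      ⋃ E ∈ 𝓕, f E := fun 𝓕 𝓕' h => biUnion_subset_biUnion_left h
  rw [iUnion_eq_iUnion_finset, hmono.measure_iUnion]
  refine iSup_le fun 𝓕 => ?_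
  let κ := (𝓕.biUnion fun E => E.image Prod.fst : Finset (ℕ × Option ℕ × Finset ℕ))
  -- The tolerance `1 / 2` makes the condition open, while for the integer counts of the exceedances
  -- it still means equality.
  let U : Set (κ → ℝ) := ⋃ E ∈ 𝓕.filter (ev · ⊆ G), ⋂ c ∈ E,
    {v | ∀ h : c.1 ∈ κ, |v ⟨c.1, h⟩ - c.2| < 1 / 2}
  have hU : IsOpen U := by
    refine isOpen_biUnion fun E _ => isOpen_biInter_finset fun c _ => ?_
    by_cases h : c.1 ∈ κ
    · have : {v : κ → ℝ | ∀ h : c.1 ∈ κ, |v ⟨c.1, h⟩ - c.2| < 1 / 2} =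
          {v : κ → ℝ | |v ⟨c.1, h⟩ - (c.2 : ℝ)| < 1 / 2} := by
        ext v
        exact ⟨fun hv => hv h, fun hv _ => hv⟩
      rw [this]
      exact isOpen_lt (((continuous_apply _).sub continuous_const).abs) continuous_const
    · have : {v : κ → ℝ | ∀ h : c.1 ∈ κ, |v ⟨c.1, h⟩ - c.2| < 1 / 2} = univ :=
        eq_univ_of_forall fun v h' => absurd h' h
      rw [this]
      exact isOpen_univ
  have key := measure_le_liminf_exceedances p₀ hα hX hX_indep h_lim h_sup hN
    (B := fun c : κ => networkCell R c.1) (fun c => hcell c.1) hU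
  refine le_trans (measure_mono ?_) (key.trans (liminf_le_liminf
    (Eventually.of_forall fun n => measure_mono ?_)))
  · intro ω hω
    obtain ⟨E, hE, hωE⟩ := mem_iUnion₂.1 hω
    by_cases hEG : ev E ⊆ G
    · rw [show f E = N ⁻¹' ev E from if_pos hEG] at hωE
      refine mem_iUnion₂.2 ⟨E, Finset.mem_filter.2 ⟨hE, hEG⟩, mem_iInter₂.2 fun c hc h => ?_⟩
      change |((N ω).1 (networkCell R c.1)).toReal - c.2| < 1 / 2
      rw [hωE c hc]
      simp
    · rw [show f E = ∅ from if_neg hEG] at hωE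
      exact absurd hωE (notMem_empty ω)
  · intro ω hω
    obtain ⟨E, hE, hωE⟩ := mem_iUnion₂.1 hω
    obtain ⟨hE, hEG⟩ := Finset.mem_filter.1 hE
    refine hEG fun c hc => ?_
    have hcκ : c.1 ∈ κ := Finset.mem_biUnion.2 ⟨E, hE, Finset.mem_image_of_mem _ hc⟩
    have h1 := mem_iInter₂.1 hωE c hc hcκ
    obtain ⟨k, hk⟩ := exists_nat_exceedances_apply (fun i => X n i ω)
      (measurableSet_of_mem_continuityRing (hcell c.1))
    change |((exceedances fun i => X n i ω).1 (networkCell R c.1)).toReal - c.2| < 1 / 2 at h1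
    rw [hk, ENNReal.toReal_natCast] at h1
    have h2 : |(k : ℤ) - (c.2 : ℤ)| < 1 := by
      have h3 : |((k : ℤ) : ℝ) - ((c.2 : ℤ) : ℝ)| < 1 := by push_cast; linarith
      exact_mod_cast h3
    have h4 : k = c.2 := by
      have := Int.abs_lt_one_iff.1 h2
      omega
    rw [hk, h4]

end Convergence

end

/-! ### Weak convergence of the exceedance processes. -/

theorem mainTheorem9
    (I : Set ℝ) (hI_ne : I.Nonempty) (hI_closed : IsClosed I) (hI_int : I.OrdConnected)
    (ℓ : ℕ) (hℓ : 0 < ℓ)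
    (α : ℝ) (hα : 0 < α)
    (ν : Measure (UnitSphere I ℓ)) [IsProbabilityMeasure ν]
    (m : ℕ → ℕ)
    (Ω : ℕ → Type*) [∀ n, MeasurableSpace (Ω n)]
    (P : ∀ n, Measure (Ω n)) [∀ n, IsProbabilityMeasure (P n)]
    (X : ∀ n, Fin (m n) → Ω n → CadlagVec I ℓ)
    (hX_meas : ∀ n i, Measurable (X n i))
    (hX_fin : ∀ n i, ∀ᵐ ω ∂P n, (X n i ω).supNorm < ∞)
    (hX_indep : ∀ n, iIndepFun (X n) (P n))
    (h_lim : ∀ x : ℝ, 0 < x → ∀ A : Set (UnitSphere I ℓ), MeasurableSet A → ν (frontier A) = 0 →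
      Tendsto
        (fun n => ∑ i, P n {ω | ENNReal.ofReal x < (X n i ω).supNorm ∧
          ∃ h : HasDirection (X n i ω), direction (X n i ω) h ∈ A})
        atTop (𝓝 (ENNReal.ofReal (x ^ (-α)) * ν A)))
    (h_sup : ∀ x : ℝ, 0 < x →
      Tendsto (fun n => ⨆ i, P n {ω | ENNReal.ofReal x < (X n i ω).supNorm}) atTop (𝓝 0))
    {Ω' : Type*} [MeasurableSpace Ω'] (P' : Measure Ω') [IsProbabilityMeasure P']
    (N : Ω' → BddFinMeasure I ℓ)
    (hN : IsPoissonPointProcess P' N (polarMean α ν)) :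
    TendstoInDistribution (fun n ω => exceedances (fun i => X n i ω)) atTop N P P' := by
  have := CadlagVec.secondCountableTopology (ℓ := ℓ) hI_ne hI_closed hI_int
  obtain ⟨w₀⟩ : Nonempty (UnitSphere I ℓ) := ν.nonempty_of_neZero
  have hm : ∀ n, Measurable fun ω => exceedances fun i => X n i ω := fun n =>
    measurable_exceedances (⟨1, one_pos⟩, w₀) (hX_meas n)
  refine ⟨fun n => (hm n).aemeasurable, hN.measurable.aemeasurable, ?_⟩
  -- This direction of the portmanteau theorem needs no metric on the space of measures, only that
  -- open sets are measurable.
  refine tendsto_of_forall_isOpen_le_liminf' fun G hG => ?_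
  change P'.map N G ≤ liminf (fun n => (P n).map (fun ω => exceedances fun i => X n i ω) G) atTop
  rw [Measure.map_apply hN.measurable hG.measurableSet]
  simp only [Measure.map_apply (hm _) hG.measurableSet]
  exact measure_preimage_le_liminf_exceedances hα hX_meas hX_indep h_lim h_sup hN hG
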